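/- For $\alpha\in\mathbb C\setminus\{0\}$ consider the lattice equation $$(u_{n+1,m+1}+1)(u_{n,m}-1)u_{n,m+1}=\alpha\,(u_{n,m+1}+1)(u_{n+1,m}-1)u_{n,m},\qquad n,m\in\mathbb Z, \tag{$*$}$$ for an unknown $u:\mathbb Z^2\to\mathbb C$. A first integral of $(*)$ of order $k\ge 1$ in the first direction is a family of functions $W_1=w_{n,m}(u_{n,m},u_{n+1,m},\dots,u_{n+k,m})$, $n,m\in\mathbb Z$, each $w_{n,m}$ holomorphic on a dense open subset of $\mathbb C^{k+1}$, such that $\partial w_{n,m}/\partial u_{n,m}\not\equiv0$ for some $n,m$, $\partial w_{n,m}/\partial u_{n+k,m}\not\equiv0$ for some $n,m$, and, on every solution of $(*)$, the values of $W_1$ at $(n,m)$ and $(n,m+1)$ coincide whenever both are defined. A first integral of order $l\ge1$ in the second direction is, likewise, a family $W_2=w_{n,m}(u_{n,m},u_{n,m+1},\dots,u_{n,m+l})$ that depends on $u_{n,m}$ and on $u_{n,m+l}$ in the same sense and whose values at $(n,m)$ and $(n+1,m)$ coincide on every solution. The equation is Darboux integrable if it has first integrals in both directions. **Theorem.** Let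 $N\ge1$ and let $\alpha\in\mathbb C$ satisfy $\alpha^N=-1$ and $\alpha^j\ne-1$ for $1\le j<N$. Then: 1. Equation $(*)$ is Darboux integrable. Explicitly, let $\sum_{i=0}^{N+1}a_iX^i=(X-1)\prod_{j=0}^{N-1}(X+\alpha^j)$, let $\sum_{i=0}^{N}b_{i,n}X^i=(X+\alpha^n)\prod_{j=1}^{N-1}(X-\alpha^{n-j})$, and let $Z_{n,m}=\alpha^n\frac{u_{n,m}-1}{u_{n,m+1}+1}$. Then $$W_1=\alpha^{-m}\,\frac{\sum_{i=0}^{N+1}a_i\prod_{r=0}^{i}u_{n+r,m}}{\sum_{i=0}^{N+1}a_i\prod_{r=0}^{i-1}u_{n+r,m}},\qquad W_2=\frac{\sum_{i=0}^{N}b_{i,n}\prod_{r=0}^{i}Z_{n,m+r}}{\sum_{i=0}^{N}b_{i,n}\prod_{r=0}^{i-1}Z_{n,m+r}}$$ are first integrals of order $N+1$ in the first and in the second direction, respectively. 2. In each of the two directions, the minimal order of a first integral of $(*)$ equals $N$ or $N+1$. Consequently, for every $M\in\mathbb N$ there is an $\alpha\ne0$ for which $(*)$ is Darboux integrable and the minimal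 orders of its first integrals in both directions are at least $M$. -/

import Mathlib

/-- The set of solutions `u : ℤ × ℤ → ℂ` of the Burgers-type lattice equation with parameter `α`. -/
def burgersSolutions (α : ℂ) : Set (ℤ → ℤ → ℂ) :=
  {u | ∀ n m : ℤ,
    (u (n + 1) (m + 1) + 1) * (u n m - 1) * u n (m + 1)
      = α * (u n (m + 1) + 1) * (u (n + 1) m - 1) * u n m}

/-- The tuple `(u_{n,m}, u_{n+1,m}, …, u_{n+k,m})`. -/
def rowTuple (u : ℤ → ℤ → ℂ) (k : ℕ) (n m : ℤ) : Fin (k + 1) → ℂ :=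
  fun i => u (n + (i : ℕ)) m

/-- The tuple `(u_{n,m}, u_{n,m+1}, …, u_{n,m+l})`. -/
def colTuple (u : ℤ → ℤ → ℂ) (l : ℕ) (n m : ℤ) : Fin (l + 1) → ℂ :=
  fun i => u n (m + (i : ℕ))

/-- `w = (w_{n,m})` is a family of functions of `k + 1 ≥ 2` complex variables, each `w_{n,m}`
holomorphic on the dense open set `D_{n,m}`, and the family has order exactly `k`: the partial
derivative with respect to the first variable is nonzero for at least some `n, m`, and so is the
one with respect to the last variable. This covers rational and meromorphic functions as well as
branches of multivalued functions; off `D_{n,m}` the values of `w_{n,m}` carry no information. -/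
structure IsFamilyOfOrder (k : ℕ) (w : ℤ → ℤ → (Fin (k + 1) → ℂ) → ℂ)
    (D : ℤ → ℤ → Set (Fin (k + 1) → ℂ)) : Prop where
  one_le : 1 ≤ k
  isOpen : ∀ n m, IsOpen (D n m)
  dense : ∀ n m, Dense (D n m)
  holomorphic : ∀ n m, AnalyticOnNhd ℂ (w n m) (D n m)
  deriv_first : ∃ n m, ∃ x ∈ D n m, fderiv ℂ (w n m) x (Pi.single 0 1) ≠ 0
  deriv_last : ∃ n m, ∃ x ∈ D n m, fderiv ℂ (w n m) x (Pi.single (Fin.last k) 1) ≠ 0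

/-- `W_{n,m} = w_{n,m}(u_{n,m}, …, u_{n+k,m})` is a first integral of order `k` in the first
direction of the lattice equation with solution set `S`: the relation `(T₂ - 1) W = 0` holds on all
solutions, wherever both sides are defined. -/
def IsFirstIntegral₁ (S : Set (ℤ → ℤ → ℂ)) (k : ℕ)
    (w : ℤ → ℤ → (Fin (k + 1) → ℂ) → ℂ) : Prop :=
  ∃ D : ℤ → ℤ → Set (Fin (k + 1) → ℂ), IsFamilyOfOrder k w D ∧
    ∀ u ∈ S, ∀ n m : ℤ, rowTuple u k n m ∈ D n m → rowTuple u k n (m + 1) ∈ D n (m + 1) →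
      w n (m + 1) (rowTuple u k n (m + 1)) = w n m (rowTuple u k n m)

/-- `W_{n,m} = w_{n,m}(u_{n,m}, …, u_{n,m+l})` is a first integral of order `l` in the second
direction of the lattice equation with solution set `S`: the relation `(T₁ - 1) W = 0` holds on all
solutions, wherever both sides are defined. -/
def IsFirstIntegral₂ (S : Set (ℤ → ℤ → ℂ)) (l : ℕ)
    (w : ℤ → ℤ → (Fin (l + 1) → ℂ) → ℂ) : Prop :=
  ∃ D : ℤ → ℤ → Set (Fin (l + 1) → ℂ), IsFamilyOfOrder l w D ∧
    ∀ u ∈ S, ∀ n m : ℤ, colTuple u l n m ∈ D n m → colTuple u l (n + 1) m ∈ D (n + 1) m →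
      w (n + 1) m (colTuple u l (n + 1) m) = w n m (colTuple u l n m)

/-- The orders of the first integrals in the first direction. -/
def firstIntegralOrders₁ (S : Set (ℤ → ℤ → ℂ)) : Set ℕ :=
  {k | ∃ w, IsFirstIntegral₁ S k w}

/-- The orders of the first integrals in the second direction. -/
def firstIntegralOrders₂ (S : Set (ℤ → ℤ → ℂ)) : Set ℕ :=
  {l | ∃ w, IsFirstIntegral₂ S l w}

/-- Darboux integrability: there are first integrals in both directions. -/
def IsDarbouxIntegrable (S : Set (ℤ → ℤ → ℂ)) : Prop :=
  (∃ k w, IsFirstIntegral₁ S k w) ∧ (∃ l w, IsFirstIntegral₂ S l w)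

/-- The polynomial `(X - 1)(X + α^{N-1}) ⋯ (X + α)(X + 1)`, of degree `N + 1`. -/
noncomputable def burgersPoly₁ (N : ℕ) (α : ℂ) : Polynomial ℂ :=
  (Polynomial.X - 1) * ∏ j ∈ Finset.range N, (Polynomial.X + Polynomial.C (α ^ j))

/-- The polynomial `(X + α^n)(X - α^{n-N+1}) ⋯ (X - α^{n-1})`, of degree `N` (for `N ≥ 1`). -/
noncomputable def burgersPoly₂ (N : ℕ) (α : ℂ) (n : ℤ) : Polynomial ℂ :=
  (Polynomial.X + Polynomial.C (α ^ n)) *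
    ∏ j ∈ Finset.Ico 1 N, (Polynomial.X - Polynomial.C (α ^ (n - (j : ℤ))))

/-- With `∑ aᵢ Xⁱ = burgersPoly₁ N α`, the function
`α^{-m} (a₀ x₀ + a₁ x₀ x₁ + ⋯ + a_{N+1} x₀ ⋯ x_{N+1}) / (a₀ + a₁ x₀ + ⋯ + a_{N+1} x₀ ⋯ x_N)`. -/
noncomputable def burgersIntegral₁ (N : ℕ) (α : ℂ) (_n m : ℤ) (x : Fin (N + 1 + 1) → ℂ) : ℂ :=
  α ^ (-m) *
    ((∑ i : Fin (N + 1 + 1), (burgersPoly₁ N α).coeff i * ∏ r ∈ Finset.Iic i, x r) /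
     (∑ i : Fin (N + 1 + 1), (burgersPoly₁ N α).coeff i * ∏ r ∈ Finset.Iio i, x r))

/-- With `∑ bᵢ Xⁱ = burgersPoly₂ N α n` and `Zᵢ = αⁿ (xᵢ - 1) / (x_{i+1} + 1)`, the function
`(b₀ Z₀ + b₁ Z₀ Z₁ + ⋯ + b_N Z₀ ⋯ Z_N) / (b₀ + b₁ Z₀ + ⋯ + b_N Z₀ ⋯ Z_{N-1})`. -/
noncomputable def burgersIntegral₂ (N : ℕ) (α : ℂ) (n _m : ℤ) (x : Fin (N + 1 + 1) → ℂ) : ℂ :=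
  let Z : Fin (N + 1) → ℂ := fun i => α ^ n * ((x i.castSucc - 1) / (x i.succ + 1))
  (∑ i : Fin (N + 1), (burgersPoly₂ N α n).coeff i * ∏ r ∈ Finset.Iic i, Z r) /
    (∑ i : Fin (N + 1), (burgersPoly₂ N α n).coeff i * ∏ r ∈ Finset.Iio i, Z r)

/-!
The discrete Hopf–Cole substitution `u_{n,m} = v_{n+1,m} / v_{n,m}` linearises the equation to
`v_{n+1,m+1} + v_{n,m+1} = αⁿ (v_{n+1,m} - v_{n,m})`. If `L_m` is the functional on polynomials
sending `Xⁱ` to `v_{n+i,m}`, this says `L_{m+1}((X + 1) q) = αⁿ L_m((X - 1) q(αX))`. As `α^N = -1`,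
the polynomial `p` in `W₁` can be written as `(X + 1) q` with `(X - 1) q(αX)` proportional to `p`.
So both `L_m (X p)` and `L_m p` get multiplied by constants, and their ratio is `W₁` up to a power
of `α`. The columns are treated in the same way through the products of the `Z_{n,m}`.

For the lower bound, let `W` be a first integral of order `k`, seen as a function of a row of `v`.
Successive rows are linked by a linear relation with a one-dimensional kernel on either side, so the
differential of `W` kills the geometric sequence that has zero as a partner in the previous row, and
inductively its images under the relation, whose ratios are `-1, -α, -α², …`. If `k < N`, then
`k + 2` of them are defined and distinct, and by the Vandermonde determinant the differential of `W`
vanishes. For columns the same argument runs with the ratios `αⁿ, αⁿ⁻¹, …` of a potential.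
-/

open Polynomial Filter Topology

section Moments

variable {R K : Type*} [CommRing R] [Field K]

/-- The linear functional on polynomials with moments `A i`, sending `X ^ i` to `A i`. -/
noncomputable def momentFunctional (A : ℕ → R) : R[X] →ₗ[R] R :=
  Polynomial.lsum fun i => A i • LinearMap.id

theorem momentFunctional_monomial (A : ℕ → R) (i : ℕ) (c : R) :
    momentFunctional A (monomial i c) = c * A i := by
  simp [momentFunctional, Polynomial.lsum_apply, mul_comm]

theorem momentFunctional_eq_sum_range (A : ℕ → R) {p : R[X]} {d : ℕ} (hd : p.natDegree < d) :
    momentFunctional A p = ∑ i ∈ Finset.range d, p.coeff i * A i := by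
  conv_lhs => rw [p.as_sum_range' d hd]
  simp only [map_sum, momentFunctional_monomial]

theorem momentFunctional_X_mul (A : ℕ → R) (p : R[X]) :
    momentFunctional A (X * p) = momentFunctional (fun i => A (i + 1)) p := by
  induction p using Polynomial.induction_on' with
  | add p q hp hq => rw [mul_add, map_add, map_add, hp, hq]
  | monomial i c => rw [X_mul_monomial, momentFunctional_monomial, momentFunctional_monomial]

theorem momentFunctional_X_sub_C_mul_monomial (A : ℕ → R) (β c : R) (i : ℕ) :
    momentFunctional A ((X - C β) * monomial i c) = c * (A (i + 1) - β * A i) := by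
  rw [sub_mul, map_sub, momentFunctional_X_mul, C_mul_monomial, momentFunctional_monomial,
    momentFunctional_monomial]
  ring

theorem momentFunctional_X_sub_C_mul_comp {A B : ℕ → R} {d : ℕ} {c₁ c₂ β β' γ : R}
    (h : ∀ i ≤ d, c₁ * (B (i + 1) - β * B i) = c₂ * (γ ^ i * (A (i + 1) - β' * A i)))
    {q : R[X]} (hq : q.natDegree ≤ d) :
    c₁ * momentFunctional B ((X - C β) * q) =
      c₂ * momentFunctional A ((X - C β') * q.comp (C γ * X)) := by
  rw [q.as_sum_range' (d + 1) (by lia), Polynomial.sum_comp]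
  simp only [Finset.mul_sum, map_sum]
  refine Finset.sum_congr rfl fun i hi => ?_
  have hcomp : (monomial i (q.coeff i)).comp (C γ * X) = monomial i (q.coeff i * γ ^ i) := by
    rw [monomial_comp, mul_pow, ← C_pow, ← mul_assoc, ← C_mul, C_mul_X_pow_eq_monomial]
  rw [hcomp, momentFunctional_X_sub_C_mul_monomial, momentFunctional_X_sub_C_mul_monomial]
  linear_combination q.coeff i * h i (Nat.lt_succ_iff.1 (Finset.mem_range.1 hi))

/-- The quotient `(p₀ A₁ + p₁ A₂ + ⋯) / (p₀ A₀ + p₁ A₁ + ⋯)`, which is the shape of both first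
integrals. -/
noncomputable def momentRatio (A : ℕ → K) (p : K[X]) : K :=
  momentFunctional A (X * p) / momentFunctional A p

theorem momentRatio_neg (A : ℕ → K) (p : K[X]) : momentRatio A (-p) = momentRatio A p := by
  rw [momentRatio, mul_neg, map_neg, map_neg, neg_div_neg_eq, momentRatio]

theorem momentRatio_X_sub_C_mul_comp {A B : ℕ → K} {d : ℕ} {c₁ c₂ β β' γ : K}
    (hc₁ : c₁ ≠ 0) (hc₂ : c₂ ≠ 0)
    (h : ∀ i ≤ d, c₁ * (B (i + 1) - β * B i) = c₂ * (γ ^ i * (A (i + 1) - β' * A i)))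
    {q : K[X]} (hq : q.natDegree < d) :
    momentRatio B ((X - C β) * q) = γ * momentRatio A ((X - C β') * q.comp (C γ * X)) := by
  have hden := momentFunctional_X_sub_C_mul_comp h hq.le
  have hnum := momentFunctional_X_sub_C_mul_comp h (q := X * q)
    (natDegree_mul_le.trans (by rw [natDegree_X]; lia))
  have hcomp : (X - C β') * (X * q).comp (C γ * X) =
      γ • (X * ((X - C β') * q.comp (C γ * X))) := by
    rw [mul_comp, X_comp, smul_eq_C_mul]
    ring
  rw [hcomp, map_smul, smul_eq_mul, mul_left_comm, mul_left_comm c₂] at hnum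
  rw [momentRatio, momentRatio, ← mul_div_mul_left _ _ hc₁, hnum, hden, mul_div_assoc,
    mul_div_mul_left _ _ hc₂]

end Moments

section PartialProducts

variable {K : Type*} [Field K] {d : ℕ}

theorem prod_Iio_fin_eq_prod_range (a : ℕ → K) (i : Fin d) :
    ∏ r ∈ Finset.Iio i, a r = ∏ r ∈ Finset.range i, a r := by
  rw [← Nat.Iio_eq_range, ← Fin.map_valEmbedding_Iio, Finset.prod_map]
  rfl

theorem prod_Iic_fin_eq_prod_range (a : ℕ → K) (i : Fin d) :
    ∏ r ∈ Finset.Iic i, a r = ∏ r ∈ Finset.range (i + 1), a r := by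
  rw [Nat.range_succ_eq_Iic, ← Fin.map_valEmbedding_Iic, Finset.prod_map]
  rfl

/-- The numerator `p₀ z₀ + p₁ z₀ z₁ + ⋯ + p_d z₀ ⋯ z_d`. -/
noncomputable def partialProdNum (p : K[X]) (z : Fin (d + 1) → K) : K :=
  ∑ i : Fin (d + 1), p.coeff i * ∏ r ∈ Finset.Iic i, z r

/-- The denominator `p₀ + p₁ z₀ + ⋯ + p_d z₀ ⋯ z_{d-1}`. -/
noncomputable def partialProdDen (p : K[X]) (z : Fin (d + 1) → K) : K :=
  ∑ i : Fin (d + 1), p.coeff i * ∏ r ∈ Finset.Iio i, z r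

/-- The moment ratio of the sequence of partial products `1, z₀, z₀ z₁, …` of a tuple. -/
noncomputable def partialProdRatio (p : K[X]) (z : Fin (d + 1) → K) : K :=
  partialProdNum p z / partialProdDen p z

theorem partialProdRatio_eq_momentRatio {p : K[X]} (hp : p.natDegree ≤ d) (a : ℕ → K) :
    partialProdRatio p (fun i : Fin (d + 1) => a i) =
      momentRatio (fun i => ∏ r ∈ Finset.range i, a r) p := by
  have hd : p.natDegree < d + 1 := by lia
  rw [momentRatio, momentFunctional_X_mul, momentFunctional_eq_sum_range _ hd,
    momentFunctional_eq_sum_range _ hd, partialProdRatio, partialProdNum, partialProdDen]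
  simp only [prod_Iio_fin_eq_prod_range, prod_Iic_fin_eq_prod_range]
  congr 1
  · exact Fin.sum_univ_eq_sum_range (fun i => p.coeff i * ∏ r ∈ Finset.range (i + 1), a r) (d + 1)
  · exact Fin.sum_univ_eq_sum_range (fun i => p.coeff i * ∏ r ∈ Finset.range i, a r) (d + 1)

end PartialProducts

section Derivatives

variable {𝕜 : Type*} [NontriviallyNormedField 𝕜] {d : ℕ} {p : 𝕜[X]}

theorem analyticAt_pi_apply {ι : Type*} [Fintype ι] (i : ι) (z : ι → 𝕜) :
    AnalyticAt 𝕜 (fun z : ι → 𝕜 => z i) z :=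
  (ContinuousLinearMap.proj (R := 𝕜) (φ := fun _ : ι => 𝕜) i).analyticAt z

theorem hasDerivAt_add_smul_apply {ι : Type*} (z v : ι → 𝕜) (i : ι) :
    HasDerivAt (fun t : 𝕜 => (z + t • v) i) (v i) 0 :=
  (hasDerivAt_mul_const (v i)).const_add (z i)

theorem analyticAt_partialProdNum (z : Fin (d + 1) → 𝕜) :
    AnalyticAt 𝕜 (partialProdNum p) z :=
  Finset.analyticAt_fun_sum _ fun _ _ => analyticAt_const.mul
    (Finset.analyticAt_fun_prod _ fun r _ => analyticAt_pi_apply r z)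

theorem analyticAt_partialProdDen (z : Fin (d + 1) → 𝕜) :
    AnalyticAt 𝕜 (partialProdDen p) z :=
  Finset.analyticAt_fun_sum _ fun _ _ => analyticAt_const.mul
    (Finset.analyticAt_fun_prod _ fun r _ => analyticAt_pi_apply r z)

theorem analyticAt_partialProdRatio {z : Fin (d + 1) → 𝕜} (hz : partialProdDen p z ≠ 0) :
    AnalyticAt 𝕜 (partialProdRatio p) z :=
  (analyticAt_partialProdNum z).div (analyticAt_partialProdDen z) hz

theorem partialProdDen_zero : partialProdDen p (0 : Fin (d + 1) → 𝕜) = p.coeff 0 := by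
  rw [partialProdDen, Fin.sum_univ_succ, Finset.sum_eq_zero]
  · simp
  · intro i _
    rw [Finset.prod_eq_zero (Finset.mem_Iio.2 (Fin.succ_pos i)) rfl, mul_zero]

theorem partialProdNum_smul_single_zero (t : 𝕜) :
    partialProdNum p (t • Pi.single 0 1 : Fin (d + 1) → 𝕜) = t * p.coeff 0 := by
  rw [partialProdNum, Fin.sum_univ_succ, Finset.sum_eq_zero]
  · rw [show Finset.Iic (0 : Fin (d + 1)) = {0} from Finset.Iic_bot]
    simp [mul_comm]
  · intro i _
    rw [Finset.prod_eq_zero (Finset.mem_Iic.2 le_rfl) (by simp), mul_zero]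

theorem fderiv_partialProdRatio_single_zero (hp : p.coeff 0 ≠ 0) :
    fderiv 𝕜 (partialProdRatio p) (0 : Fin (d + 1) → 𝕜) (Pi.single 0 1) = 1 := by
  have hden : partialProdDen p (0 : Fin (d + 1) → 𝕜) ≠ 0 := by rwa [partialProdDen_zero]
  have hnum : HasDerivAt (fun t : 𝕜 => partialProdNum p (0 + t • Pi.single 0 1 : Fin (d + 1) → 𝕜))
      (p.coeff 0) 0 := by
    simp only [zero_add, partialProdNum_smul_single_zero]
    exact hasDerivAt_mul_const _
  have hden' := ((analyticAt_partialProdDen (p := p)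
    (0 : Fin (d + 1) → 𝕜)).differentiableAt.hasFDerivAt.hasLineDerivAt (Pi.single 0 1))
  rw [← (analyticAt_partialProdRatio hden).differentiableAt.lineDeriv_eq_fderiv]
  refine (HasDerivAt.div hnum hden' (by simpa using hden)).deriv.trans ?_
  simp [partialProdDen_zero, hp, ← pow_two,
    show partialProdNum p (0 : Fin (d + 1) → 𝕜) = 0 by
      simpa using partialProdNum_smul_single_zero (p := p) (d := d) (0 : 𝕜)]

theorem prod_Iio_add_smul_single_last (z : Fin (d + 1) → 𝕜) (t : 𝕜) (i : Fin (d + 1)) :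
    ∏ r ∈ Finset.Iio i, (z + t • Pi.single (Fin.last d) 1 : Fin (d + 1) → 𝕜) r =
      ∏ r ∈ Finset.Iio i, z r := by
  refine Finset.prod_congr rfl fun r hr => ?_
  simp [((Finset.mem_Iio.1 hr).trans_le (Fin.le_last i)).ne]

theorem partialProdDen_add_smul_single_last (z : Fin (d + 1) → 𝕜) (t : 𝕜) :
    partialProdDen p (z + t • Pi.single (Fin.last d) 1) = partialProdDen p z := by
  simp only [partialProdDen, prod_Iio_add_smul_single_last]

theorem partialProdNum_add_smul_single_last (z : Fin (d + 1) → 𝕜) (t : 𝕜) :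
    partialProdNum p (z + t • Pi.single (Fin.last d) 1) =
      partialProdNum p z + t * (p.coeff d * ∏ r ∈ Finset.Iio (Fin.last d), z r) := by
  have hcast (i : Fin d) :
      (z + t • Pi.single (Fin.last d) 1 : Fin (d + 1) → 𝕜) i.castSucc = z i.castSucc := by simp
  have hlast : (z + t • Pi.single (Fin.last d) 1 : Fin (d + 1) → 𝕜) (Fin.last d) =
      z (Fin.last d) + t := by simp
  simp only [partialProdNum, ← Finset.prod_Iio_mul_eq_prod_Iic, prod_Iio_add_smul_single_last,
    Fin.sum_univ_castSucc, hcast, hlast, Fin.val_last]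
  ring

theorem fderiv_partialProdRatio_single_last {z : Fin (d + 1) → 𝕜} (hz : partialProdDen p z ≠ 0) :
    fderiv 𝕜 (partialProdRatio p) z (Pi.single (Fin.last d) 1) =
      p.coeff d * (∏ r ∈ Finset.Iio (Fin.last d), z r) / partialProdDen p z := by
  rw [← (analyticAt_partialProdRatio hz).differentiableAt.lineDeriv_eq_fderiv, lineDeriv]
  simp only [partialProdRatio, partialProdDen_add_smul_single_last,
    partialProdNum_add_smul_single_last]
  exact (((hasDerivAt_mul_const _).const_add _).div_const _).deriv

end Derivatives

section Invariance

variable {K : Type*} [Field K]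

theorem prod_range_rows_recurrence {α : K} {a b : ℕ → K} {d : ℕ}
    (heq : ∀ i, (b (i + 1) + 1) * (a i - 1) * b i = α * (b i + 1) * (a (i + 1) - 1) * a i)
    (hb : ∀ i ≤ d, b i ≠ -1) :
    ∀ i ≤ d, (a 0 - 1) * (∏ r ∈ Finset.range (i + 1), b r + ∏ r ∈ Finset.range i, b r) =
      (b 0 + 1) *
        (α ^ i * (∏ r ∈ Finset.range (i + 1), a r - ∏ r ∈ Finset.range i, a r)) := by
  intro i
  induction i with
  | zero =>
    intro _
    simp only [zero_add, Finset.prod_range_one, Finset.prod_range_zero, pow_zero, one_mul]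
    ring
  | succ i ih =>
    intro hi
    refine mul_left_cancel₀ (a := b i + 1)
      (fun h => hb i (by lia) (eq_neg_of_add_eq_zero_left h)) ?_
    have ih := ih (by lia)
    simp only [Finset.prod_range_succ] at ih ⊢
    linear_combination b i * (b (i + 1) + 1) * ih +
      (b 0 + 1) * α ^ i * (∏ r ∈ Finset.range i, a r) * heq i

theorem mul_prod_range_eq_of_mul_succ_eq {a y z : ℕ → K} {d : ℕ}
    (h : ∀ i < d, y i * a i = z i * a (i + 1)) :
    ∀ i ≤ d, a 0 * ∏ r ∈ Finset.range i, y r = (∏ r ∈ Finset.range i, z r) * a i := by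
  intro i
  induction i with
  | zero => simp
  | succ i ih =>
    intro hi
    rw [Finset.prod_range_succ, Finset.prod_range_succ, ← mul_assoc, ih (by lia)]
    linear_combination (∏ r ∈ Finset.range i, z r) * h i hi

theorem prod_range_columns_recurrence {c : K} {a y z : ℕ → K} {d : ℕ}
    (hz : ∀ i ≤ d, z i * (a (i + 1) + 1) = c * (a i - 1))
    (hy : ∀ i ≤ d, y i * a i = z i * a (i + 1)) :
    ∀ i ≤ d, a 0 * (∏ r ∈ Finset.range (i + 1), y r - c * ∏ r ∈ Finset.range i, y r) =
      -(∏ r ∈ Finset.range (i + 1), z r + c * ∏ r ∈ Finset.range i, z r) := by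
  intro i hi
  have htel := mul_prod_range_eq_of_mul_succ_eq (d := d + 1) fun i hi => hy i (by lia)
  have hsucc := htel (i + 1) (by lia)
  rw [Finset.prod_range_succ _ i] at hsucc ⊢
  rw [Finset.prod_range_succ _ i] at hsucc ⊢
  linear_combination hsucc - c * htel i (by lia) + (∏ r ∈ Finset.range i, z r) * hz i hi

/-- The tuple `Zᵢ = c (xᵢ - 1) / (x_{i+1} + 1)` attached to a piece `x` of a column, with
`c = αⁿ`. -/
noncomputable def zTuple {d : ℕ} (c : K) (x : Fin (d + 1 + 1) → K) : Fin (d + 1) → K :=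
  fun i => c * ((x i.castSucc - 1) / (x i.succ + 1))

end Invariance

theorem ne_zero_of_pow_eq_neg_one {N : ℕ} {α : ℂ} (hα : α ^ N = -1) : N ≠ 0 ∧ α ≠ 0 := by
  have hN : N ≠ 0 := by
    rintro rfl
    norm_num at hα
  refine ⟨hN, ?_⟩
  rintro rfl
  norm_num [hN] at hα

theorem burgersPoly₁_monic (N : ℕ) (α : ℂ) : (burgersPoly₁ N α).Monic :=
  (monic_X_sub_C (1 : ℂ)).mul (monic_prod_of_monic _ _ fun _ _ => monic_X_add_C _)

theorem burgersPoly₁_natDegree (N : ℕ) (α : ℂ) : (burgersPoly₁ N α).natDegree = N + 1 := by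
  rw [burgersPoly₁, ← C_1, (monic_X_sub_C (1 : ℂ)).natDegree_mul
      (monic_prod_of_monic _ _ fun _ _ => monic_X_add_C _),
    natDegree_prod_of_monic _ _ fun _ _ => monic_X_add_C _]
  simp only [natDegree_X_sub_C, natDegree_X_add_C, Finset.sum_const, Finset.card_range,
    smul_eq_mul]
  ring

theorem burgersPoly₁_coeff_zero_ne_zero (N : ℕ) {α : ℂ} (hα : α ≠ 0) :
    (burgersPoly₁ N α).coeff 0 ≠ 0 := by
  rw [coeff_zero_eq_eval_zero, burgersPoly₁, eval_mul, eval_prod]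
  simp [Finset.prod_eq_zero_iff, hα]

theorem burgersPoly₂_monic (N : ℕ) (α : ℂ) (n : ℤ) : (burgersPoly₂ N α n).Monic :=
  (monic_X_add_C _).mul (monic_prod_of_monic _ _ fun _ _ => monic_X_sub_C _)

theorem burgersPoly₂_natDegree {N : ℕ} (hN : N ≠ 0) (α : ℂ) (n : ℤ) :
    (burgersPoly₂ N α n).natDegree = N := by
  rw [burgersPoly₂, (monic_X_add_C _).natDegree_mul
      (monic_prod_of_monic _ _ fun _ _ => monic_X_sub_C _),
    natDegree_prod_of_monic _ _ fun _ _ => monic_X_sub_C _]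
  simp only [natDegree_X_add_C, natDegree_X_sub_C, Finset.sum_const, Nat.card_Ico, smul_eq_mul]
  lia

theorem burgersPoly₂_coeff_zero_ne_zero (N : ℕ) {α : ℂ} (hα : α ≠ 0) (n : ℤ) :
    (burgersPoly₂ N α n).coeff 0 ≠ 0 := by
  rw [coeff_zero_eq_eval_zero, burgersPoly₂, eval_mul, eval_prod]
  simp [Finset.prod_eq_zero_iff, hα, zpow_ne_zero]

/-- The quotient of `burgersPoly₁ N α` by `X + 1`. -/
noncomputable def burgersQuot₁ (N : ℕ) (α : ℂ) : ℂ[X] :=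
  (X - 1) * ∏ j ∈ Finset.Ico 1 N, (X + C (α ^ j))

/-- The quotient of `burgersPoly₂ N α n` by `X + α^n`. -/
noncomputable def burgersQuot₂ (N : ℕ) (α : ℂ) (n : ℤ) : ℂ[X] :=
  ∏ j ∈ Finset.Ico 1 N, (X - C (α ^ (n - (j : ℤ))))

theorem burgersQuot₁_natDegree {N : ℕ} (hN : N ≠ 0) (α : ℂ) :
    (burgersQuot₁ N α).natDegree = N := by
  rw [burgersQuot₁, ← C_1, (monic_X_sub_C (1 : ℂ)).natDegree_mul
      (monic_prod_of_monic _ _ fun _ _ => monic_X_add_C _),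
    natDegree_prod_of_monic _ _ fun _ _ => monic_X_add_C _]
  simp only [natDegree_X_sub_C, natDegree_X_add_C, Finset.sum_const, Nat.card_Ico, smul_eq_mul]
  lia

theorem burgersQuot₂_natDegree (N : ℕ) (α : ℂ) (n : ℤ) :
    (burgersQuot₂ N α n).natDegree = N - 1 := by
  rw [burgersQuot₂, natDegree_prod_of_monic _ _ fun _ _ => monic_X_sub_C _]
  simp

theorem X_add_one_mul_burgersQuot₁ {N : ℕ} (hN : N ≠ 0) (α : ℂ) :
    (X - C (-1)) * burgersQuot₁ N α = burgersPoly₁ N α := by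
  rw [burgersQuot₁, burgersPoly₁, Finset.range_eq_Ico,
    Finset.prod_eq_prod_Ico_succ_bot (Nat.pos_of_ne_zero hN), pow_zero, C_neg, C_1]
  ring

/-- The substitution `X ↦ α X` shifts the factors `X + α^j`; the factor `X + α^N = X - 1` lost at
one end is the one supplied at the other. -/
theorem X_sub_one_mul_burgersQuot₁_comp {N : ℕ} {α : ℂ} (hα : α ^ N = -1) :
    (X - C 1) * (burgersQuot₁ N α).comp (C α * X) = -burgersPoly₁ N α := by
  obtain ⟨M, rfl⟩ := Nat.exists_eq_succ_of_ne_zero (ne_zero_of_pow_eq_neg_one hα).1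
  have hC : (C α * C α ^ M : ℂ[X]) = -1 := by
    rw [← pow_succ', ← C_pow, hα, C_neg, C_1]
  have hfactor (j : ℕ) : (X + C α ^ (1 + j) : ℂ[X]).comp (C α * X) = C α * (X + C α ^ j) := by
    rw [add_comp, X_comp, pow_comp, C_comp, pow_add, pow_one]
    ring
  rw [burgersQuot₁, mul_comp, prod_comp, Finset.prod_Ico_eq_prod_range, burgersPoly₁,
    Nat.succ_eq_add_one, Nat.add_sub_cancel, Finset.prod_range_succ]
  simp only [hfactor, Finset.prod_mul_distrib, Finset.prod_const, Finset.card_range, sub_comp,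
    X_comp, one_comp, C_1, C_pow]
  linear_combination (X - 1) * (∏ j ∈ Finset.range M, (X + C α ^ j)) * X * hC

theorem X_add_C_mul_burgersQuot₂ (N : ℕ) (α : ℂ) (n : ℤ) :
    (X - C (-α ^ n)) * burgersQuot₂ N α n = burgersPoly₂ N α n := by
  rw [C_neg, sub_neg_eq_add, burgersQuot₂, burgersPoly₂]

/-- Since `α^N = -1`, the last of the factors `X - α^{n-j}`, `j < N`, is `X + α^{n+1}`. -/
theorem X_sub_C_mul_burgersQuot₂ {N : ℕ} {α : ℂ} (hα : α ^ N = -1) (n : ℤ) :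
    (X - C (α ^ n)) * burgersQuot₂ N α n = burgersPoly₂ N α (n + 1) := by
  obtain ⟨hN, h0⟩ := ne_zero_of_pow_eq_neg_one hα
  obtain ⟨M, rfl⟩ := Nat.exists_eq_succ_of_ne_zero hN
  have hlast : α ^ (n - (M : ℤ)) = -α ^ (n + 1) := by
    rw [show n - (M : ℤ) = n + 1 - ((M + 1 : ℕ) : ℤ) by push_cast; ring, zpow_sub₀ h0,
      zpow_natCast, hα, div_neg, div_one]
  calc (X - C (α ^ n)) * burgersQuot₂ (M + 1) α n
      = ∏ j ∈ Finset.range (M + 1), (X - C (α ^ (n - (j : ℤ)))) := by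
        rw [burgersQuot₂, Finset.range_eq_Ico, Finset.prod_eq_prod_Ico_succ_bot M.succ_pos]
        simp
    _ = (∏ j ∈ Finset.range M, (X - C (α ^ (n - (j : ℤ))))) * (X + C (α ^ (n + 1))) := by
        rw [Finset.prod_range_succ, hlast, C_neg, sub_neg_eq_add]
    _ = burgersPoly₂ (M + 1) α (n + 1) := by
        rw [burgersPoly₂, Finset.prod_Ico_eq_prod_range, mul_comm, Nat.add_sub_cancel]
        simp only [Nat.cast_add, Nat.cast_one, add_sub_add_right_eq_sub, add_comm 1]

theorem partialProdRatio_rows {N : ℕ} {α : ℂ} (hα : α ^ N = -1) {a b : ℕ → ℂ}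
    (heq : ∀ i, (b (i + 1) + 1) * (a i - 1) * b i = α * (b i + 1) * (a (i + 1) - 1) * a i)
    (ha : a 0 ≠ 1) (hb : ∀ i ≤ N + 1, b i ≠ -1) :
    partialProdRatio (d := N + 1) (burgersPoly₁ N α) (fun i => b i) =
      α * partialProdRatio (d := N + 1) (burgersPoly₁ N α) (fun i => a i) := by
  have hN := (ne_zero_of_pow_eq_neg_one hα).1
  have hdeg := (burgersPoly₁_natDegree N α).le
  have hb0 : b 0 + 1 ≠ 0 := fun h => hb 0 (by lia) (eq_neg_of_add_eq_zero_left h)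
  have hratio := momentRatio_X_sub_C_mul_comp (β := -1) (β' := 1) (γ := α)
    (A := fun i => ∏ r ∈ Finset.range i, a r) (B := fun i => ∏ r ∈ Finset.range i, b r)
    (sub_ne_zero.2 ha) hb0 (by simpa using prod_range_rows_recurrence heq hb)
    ((burgersQuot₁_natDegree hN α).trans_lt N.lt_succ_self)
  rwa [X_add_one_mul_burgersQuot₁ hN, X_sub_one_mul_burgersQuot₁_comp hα, momentRatio_neg,
    ← partialProdRatio_eq_momentRatio hdeg, ← partialProdRatio_eq_momentRatio hdeg] at hratio

theorem partialProdRatio_columns {N : ℕ} {α : ℂ} (hα : α ^ N = -1) (n : ℤ) {a b : ℕ → ℂ}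
    (heq : ∀ i, (b (i + 1) + 1) * (a i - 1) * a (i + 1) = α * (a (i + 1) + 1) * (b i - 1) * a i)
    (ha : ∀ i ≤ N, a i ≠ 0) (ha' : ∀ i ≤ N + 1, a i ≠ -1) (hb : ∀ i ≤ N + 1, b i ≠ -1) :
    partialProdRatio (burgersPoly₂ N α (n + 1))
        (zTuple (α ^ (n + 1)) fun i : Fin (N + 1 + 1) => b i) =
      partialProdRatio (burgersPoly₂ N α n) (zTuple (α ^ n) fun i : Fin (N + 1 + 1) => a i) := by
  obtain ⟨hN, h0⟩ := ne_zero_of_pow_eq_neg_one hα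
  set z : ℕ → ℂ := fun i => α ^ n * ((a i - 1) / (a (i + 1) + 1)) with hz
  set y : ℕ → ℂ := fun i => α ^ (n + 1) * ((b i - 1) / (b (i + 1) + 1)) with hy
  have hzi (i : ℕ) (hi : i ≤ N) : z i * (a (i + 1) + 1) = α ^ n * (a i - 1) := by
    have : a (i + 1) + 1 ≠ 0 := fun h => ha' _ (by lia) (eq_neg_of_add_eq_zero_left h)
    simp only [hz]
    field_simp
  have hyi (i : ℕ) (hi : i ≤ N) : y i * a i = z i * a (i + 1) := by
    have ha₁ : a (i + 1) + 1 ≠ 0 := fun h => ha' _ (by lia) (eq_neg_of_add_eq_zero_left h)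
    have hb₁ : b (i + 1) + 1 ≠ 0 := fun h => hb _ (by lia) (eq_neg_of_add_eq_zero_left h)
    simp only [hz, hy, zpow_add_one₀ h0]
    field_simp
    linear_combination -heq i
  have hratio := momentRatio_X_sub_C_mul_comp (β := α ^ n) (β' := -α ^ n) (γ := 1)
    (A := fun i => ∏ r ∈ Finset.range i, z r) (B := fun i => ∏ r ∈ Finset.range i, y r)
    (ha 0 N.zero_le) (neg_ne_zero.2 one_ne_zero)
    (by simpa using prod_range_columns_recurrence hzi hyi)
    (q := burgersQuot₂ N α n) (by rw [burgersQuot₂_natDegree]; lia)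
  rwa [one_mul, C_1, one_mul, comp_X, X_sub_C_mul_burgersQuot₂ hα, X_add_C_mul_burgersQuot₂,
    ← partialProdRatio_eq_momentRatio (burgersPoly₂_natDegree hN α _).le,
    ← partialProdRatio_eq_momentRatio (burgersPoly₂_natDegree hN α _).le] at hratio

theorem dense_inter_ne_zero_of_analyticOnNhd {E : Type*} [NormedAddCommGroup E] [NormedSpace ℂ E]
    {V : Set E} {F : E → ℂ} (hF : AnalyticOnNhd ℂ F V) (hVo : IsOpen V) (hVd : Dense V)
    (hVc : IsPreconnected V) {x₀ : E} (hx₀ : x₀ ∈ V) (hFx₀ : F x₀ ≠ 0) :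
    Dense (V ∩ {x | F x ≠ 0}) := by
  refine dense_closure.1 (hVd.mono fun x hx => ?_)
  rw [mem_closure_iff_frequently]
  refine Frequently.and_eventually (p := (F · ≠ 0)) (fun hzero => hFx₀ ?_) (hVo.mem_nhds hx)
    |>.mono fun y hy => hy.symm
  simp only [ne_eq, not_not] at hzero
  exact hF.eqOn_zero_of_preconnected_of_eventuallyEq_zero hVc hx hzero hx₀

section AvoidingTuples

variable {ι : Type*} {S : Set ℂ}

/-- The tuples none of whose entries lies in `S`. -/
def avoidingTuples (ι : Type*) (S : Set ℂ) : Set (ι → ℂ) :=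
  Set.univ.pi fun _ => Sᶜ

theorem mem_avoidingTuples {x : ι → ℂ} : x ∈ avoidingTuples ι S ↔ ∀ i, x i ∉ S := by
  simp [avoidingTuples]

theorem isOpen_avoidingTuples [Finite ι] (hS : S.Finite) : IsOpen (avoidingTuples ι S) :=
  isOpen_set_pi Set.finite_univ fun _ _ => hS.isClosed.isOpen_compl

theorem dense_avoidingTuples (hS : S.Finite) : Dense (avoidingTuples ι S) :=
  dense_pi _ fun _ _ => hS.countable.dense_compl ℝ

theorem isPreconnected_avoidingTuples (hS : S.Finite) : IsPreconnected (avoidingTuples ι S) :=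
  isPreconnected_univ_pi fun _ => (hS.countable.isPathConnected_compl_of_one_lt_rank
    (by simp)).isConnected.isPreconnected

end AvoidingTuples

theorem isFamilyOfOrder_of_avoidingTuples {k : ℕ} (hk : 1 ≤ k) {S T : Set ℂ} (hS : S.Finite)
    (hT : T.Finite) {w F : ℤ → ℤ → (Fin (k + 1) → ℂ) → ℂ} {x₀ : Fin (k + 1) → ℂ}
    (hF : ∀ n m, AnalyticOnNhd ℂ (F n m) (avoidingTuples _ S))
    (hx₀ : x₀ ∈ avoidingTuples _ S) (hFx₀ : ∀ n m, F n m x₀ ≠ 0)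
    (hw : ∀ n m, ∀ x ∈ avoidingTuples _ S, F n m x ≠ 0 → AnalyticAt ℂ (w n m) x)
    (hfirst : fderiv ℂ (w 0 0) x₀ (Pi.single 0 1) ≠ 0)
    (hlast : ∀ x ∈ avoidingTuples _ S ∩ {x | F 0 0 x ≠ 0}, x ∈ avoidingTuples _ T →
      fderiv ℂ (w 0 0) x (Pi.single (Fin.last k) 1) ≠ 0) :
    IsFamilyOfOrder k w fun n m => avoidingTuples _ S ∩ {x | F n m x ≠ 0} := by
  have hopen (n m : ℤ) : IsOpen (avoidingTuples _ S ∩ {x | F n m x ≠ 0}) :=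
    (hF n m).continuousOn.isOpen_inter_preimage (isOpen_avoidingTuples hS) isOpen_ne
  refine ⟨hk, hopen, fun n m => ?_, fun n m x hx => hw n m x hx.1 hx.2,
    ⟨0, 0, x₀, ⟨hx₀, hFx₀ 0 0⟩, hfirst⟩, ?_⟩
  · exact dense_inter_ne_zero_of_analyticOnNhd (hF n m) (isOpen_avoidingTuples hS)
      (dense_avoidingTuples hS) (isPreconnected_avoidingTuples hS) hx₀ (hFx₀ n m)
  · obtain ⟨x, hx, hxT⟩ :=
      (dense_avoidingTuples hT).inter_open_nonempty _ (hopen 0 0) ⟨x₀, hx₀, hFx₀ 0 0⟩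
    exact ⟨0, 0, x, hx, hlast x hx hxT⟩

theorem burgersIntegral₁_eq (N : ℕ) (α : ℂ) (n m : ℤ) :
    burgersIntegral₁ N α n m = fun x => α ^ (-m) * partialProdRatio (burgersPoly₁ N α) x :=
  rfl

theorem fderiv_burgersIntegral₁ {N : ℕ} {α : ℂ} (n m : ℤ) {x : Fin (N + 1 + 1) → ℂ}
    (hx : partialProdDen (burgersPoly₁ N α) x ≠ 0) (v : Fin (N + 1 + 1) → ℂ) :
    fderiv ℂ (burgersIntegral₁ N α n m) x v =
      α ^ (-m) * fderiv ℂ (partialProdRatio (burgersPoly₁ N α)) x v := by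
  rw [burgersIntegral₁_eq, fderiv_const_mul (analyticAt_partialProdRatio hx).differentiableAt]
  rfl

theorem isFamilyOfOrder_burgersIntegral₁ (N : ℕ) {α : ℂ} (hα : α ≠ 0) :
    IsFamilyOfOrder (N + 1) (burgersIntegral₁ N α) fun _ _ =>
      avoidingTuples _ {1, -1} ∩ {x | partialProdDen (burgersPoly₁ N α) x ≠ 0} := by
  have hcoeff := burgersPoly₁_coeff_zero_ne_zero N hα
  have hden : partialProdDen (burgersPoly₁ N α) (0 : Fin (N + 1 + 1) → ℂ) ≠ 0 := by
    rwa [partialProdDen_zero]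
  refine isFamilyOfOrder_of_avoidingTuples N.succ_pos (Set.toFinite _) (Set.finite_singleton 0)
    (F := fun _ _ => partialProdDen (burgersPoly₁ N α)) (x₀ := 0)
    (fun _ _ _ _ => analyticAt_partialProdDen _) (mem_avoidingTuples.2 (by simp))
    (fun _ _ => hden) (fun _ _ x _ hx => ?_) ?_ fun x hx hx0 => ?_
  · exact analyticAt_const.mul (analyticAt_partialProdRatio hx)
  · simp [fderiv_burgersIntegral₁ _ _ hden, fderiv_partialProdRatio_single_zero hcoeff]
  · have hlead : (burgersPoly₁ N α).coeff (N + 1) = 1 := by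
      simpa [burgersPoly₁_natDegree] using (burgersPoly₁_monic N α).coeff_natDegree
    rw [fderiv_burgersIntegral₁ _ _ hx.2, fderiv_partialProdRatio_single_last hx.2, hlead]
    have hprod : ∏ r ∈ Finset.Iio (Fin.last (N + 1)), x r ≠ 0 :=
      Finset.prod_ne_zero_iff.2 fun r _ => mem_avoidingTuples.1 hx0 r
    rw [one_mul]
    exact mul_ne_zero (zpow_ne_zero _ hα) (div_ne_zero hprod hx.2)

theorem isFirstIntegral₁_burgersIntegral₁ {N : ℕ} {α : ℂ} (hα : α ^ N = -1) :
    IsFirstIntegral₁ (burgersSolutions α) (N + 1) (burgersIntegral₁ N α) := by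
  have h0 := (ne_zero_of_pow_eq_neg_one hα).2
  refine ⟨_, isFamilyOfOrder_burgersIntegral₁ N h0, fun u hu n m hx hy => ?_⟩
  have hx := mem_avoidingTuples.1 hx.1
  have hy := mem_avoidingTuples.1 hy.1
  have hratio := partialProdRatio_rows hα (a := fun i => u (n + i) m)
    (b := fun i => u (n + i) (m + 1)) (fun i => by simpa [add_assoc] using hu (n + i) m)
    (fun h => hx 0 (Or.inl h)) (fun i hi h => hy ⟨i, by lia⟩ (Or.inr h))
  simp only [burgersIntegral₁_eq]
  unfold rowTuple
  rw [hratio, ← mul_assoc, ← zpow_add_one₀ h0, neg_add_rev, neg_add_cancel_comm]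

section ZTuple

variable {d : ℕ} (c : ℂ) {x : Fin (d + 1 + 1) → ℂ}

theorem zTuple_one : zTuple c (1 : Fin (d + 1 + 1) → ℂ) = 0 := by
  ext
  simp [zTuple]

theorem analyticAt_zTuple (hx : ∀ i, x i ≠ -1) : AnalyticAt ℂ (zTuple c) x := by
  have hne (i : Fin (d + 1)) : x i.succ + 1 ≠ 0 := fun h => hx _ (eq_neg_of_add_eq_zero_left h)
  exact AnalyticAt.pi fun i => analyticAt_const.mul
    (((analyticAt_pi_apply _ x).sub analyticAt_const).div
      ((analyticAt_pi_apply _ x).add analyticAt_const) (hne i))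

theorem fderiv_zTuple_apply (hx : ∀ i, x i ≠ -1) (v : Fin (d + 1 + 1) → ℂ) (i : Fin (d + 1)) :
    fderiv ℂ (zTuple c) x v i =
      c * ((v i.castSucc * (x i.succ + 1) - (x i.castSucc - 1) * v i.succ) /
        (x i.succ + 1) ^ 2) := by
  have hne (j : Fin (d + 1)) : (x + (0 : ℂ) • v) j.succ + 1 ≠ 0 := fun h =>
    hx j.succ (eq_neg_of_add_eq_zero_left (by simpa using h))
  have hentry (j : Fin (d + 1)) : HasDerivAt (fun t : ℂ => zTuple c (x + t • v) j) _ 0 :=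
    (((hasDerivAt_add_smul_apply x v j.castSucc).sub_const 1).div
      ((hasDerivAt_add_smul_apply x v j.succ).add_const 1) (hne j)).const_mul c
  rw [← (analyticAt_zTuple c hx).differentiableAt.lineDeriv_eq_fderiv, lineDeriv,
    deriv_pi fun j => (hentry j).differentiableAt]
  simpa using (hentry i).deriv

theorem fderiv_zTuple_single_zero (hx : ∀ i, x i ≠ -1) :
    fderiv ℂ (zTuple c) x (Pi.single 0 1) = (c / (x 1 + 1)) • Pi.single 0 1 := by
  have hne : x 1 + 1 ≠ 0 := fun h => hx _ (eq_neg_of_add_eq_zero_left h)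
  ext i
  rw [fderiv_zTuple_apply c hx]
  rcases Fin.eq_zero_or_eq_succ i with rfl | ⟨j, rfl⟩
  · simp only [Fin.castSucc_zero, Fin.succ_zero_eq_one, Pi.single_eq_same, Pi.smul_apply,
      Pi.single_eq_of_ne (one_ne_zero (α := Fin (d + 2))), smul_eq_mul, mul_zero, sub_zero, one_mul,
      mul_one]
    field_simp
  · simp

theorem fderiv_zTuple_single_last (hx : ∀ i, x i ≠ -1) :
    fderiv ℂ (zTuple c) x (Pi.single (Fin.last (d + 1)) 1) =
      (c * (1 - x (Fin.last d).castSucc) / (x (Fin.last (d + 1)) + 1) ^ 2) •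
        Pi.single (Fin.last d) 1 := by
  ext i
  rw [fderiv_zTuple_apply c hx]
  rcases Fin.eq_castSucc_or_eq_last i with ⟨j, rfl⟩ | rfl
  · simp [(Fin.castSucc_lt_last _).ne]
  · simp only [Pi.single_eq_same, Pi.single_eq_of_ne (Fin.castSucc_lt_last _).ne, Fin.succ_last,
      Pi.smul_apply, smul_eq_mul, zero_mul, zero_sub, mul_one]
    ring

end ZTuple

theorem burgersIntegral₂_eq (N : ℕ) (α : ℂ) (n m : ℤ) :
    burgersIntegral₂ N α n m = fun x => partialProdRatio (burgersPoly₂ N α n) (zTuple (α ^ n) x) :=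
  rfl

theorem fderiv_burgersIntegral₂ {N : ℕ} {α : ℂ} (n m : ℤ) {x : Fin (N + 1 + 1) → ℂ}
    (hx : ∀ i, x i ≠ -1) (hden : partialProdDen (burgersPoly₂ N α n) (zTuple (α ^ n) x) ≠ 0)
    (v : Fin (N + 1 + 1) → ℂ) :
    fderiv ℂ (burgersIntegral₂ N α n m) x v =
      fderiv ℂ (partialProdRatio (burgersPoly₂ N α n)) (zTuple (α ^ n) x)
        (fderiv ℂ (zTuple (α ^ n)) x v) := by
  rw [burgersIntegral₂_eq]
  exact DFunLike.congr_fun (fderiv_comp x (analyticAt_partialProdRatio hden).differentiableAt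
    (analyticAt_zTuple _ hx).differentiableAt) v

theorem fderiv_burgersIntegral₂_single_last_ne_zero {N : ℕ} (hN : N ≠ 0) {α : ℂ} (hα : α ≠ 0)
    (n m : ℤ) {x : Fin (N + 1 + 1) → ℂ} (hx₁ : ∀ i, x i ≠ 1) (hx : ∀ i, x i ≠ -1)
    (hden : partialProdDen (burgersPoly₂ N α n) (zTuple (α ^ n) x) ≠ 0) :
    fderiv ℂ (burgersIntegral₂ N α n m) x (Pi.single (Fin.last (N + 1)) 1) ≠ 0 := by
  have hlead : (burgersPoly₂ N α n).coeff N = 1 := by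
    simpa [burgersPoly₂_natDegree hN] using (burgersPoly₂_monic N α n).coeff_natDegree
  have hadd (i) : x i + 1 ≠ 0 := fun h => hx i (eq_neg_of_add_eq_zero_left h)
  have hprod : ∏ r ∈ Finset.Iio (Fin.last N), zTuple (α ^ n) x r ≠ 0 :=
    Finset.prod_ne_zero_iff.2 fun r _ =>
      mul_ne_zero (zpow_ne_zero _ hα) (div_ne_zero (sub_ne_zero.2 (hx₁ _)) (hadd _))
  rw [fderiv_burgersIntegral₂ _ _ hx hden, fderiv_zTuple_single_last _ hx, map_smul,
    fderiv_partialProdRatio_single_last hden, hlead, one_mul, smul_eq_mul]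
  exact mul_ne_zero (div_ne_zero (mul_ne_zero (zpow_ne_zero _ hα) (sub_ne_zero.2 (hx₁ _).symm))
    (pow_ne_zero 2 (hadd _))) (div_ne_zero hprod hden)

theorem isFamilyOfOrder_burgersIntegral₂ {N : ℕ} (hN : N ≠ 0) {α : ℂ} (hα : α ≠ 0) :
    IsFamilyOfOrder (N + 1) (burgersIntegral₂ N α) fun n _ =>
      avoidingTuples _ {0, -1} ∩
        {x | partialProdDen (burgersPoly₂ N α n) (zTuple (α ^ n) x) ≠ 0} := by
  have hcoeff := burgersPoly₂_coeff_zero_ne_zero N hα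
  have hone (i : Fin (N + 1 + 1)) : (1 : Fin (N + 1 + 1) → ℂ) i ≠ -1 := by norm_num
  have hden (n : ℤ) :
      partialProdDen (burgersPoly₂ N α n) (zTuple (α ^ n) (1 : Fin (N + 1 + 1) → ℂ)) ≠ 0 := by
    rw [zTuple_one, partialProdDen_zero]
    exact hcoeff n
  have havoid {x : Fin (N + 1 + 1) → ℂ} (hx : x ∈ avoidingTuples _ {0, -1}) (i) : x i ≠ -1 :=
    fun h => mem_avoidingTuples.1 hx i (Or.inr h)
  refine isFamilyOfOrder_of_avoidingTuples N.succ_pos (Set.toFinite _) (Set.finite_singleton 1)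
    (F := fun n _ x => partialProdDen (burgersPoly₂ N α n) (zTuple (α ^ n) x)) (x₀ := 1)
    (fun n _ x hx => (analyticAt_partialProdDen _).comp (analyticAt_zTuple _ (havoid hx)))
    (mem_avoidingTuples.2 fun i => by norm_num) (fun n _ => hden n)
    (fun n _ x hx hxden => ?_) ?_ fun x hx hx₁ => ?_
  · exact (analyticAt_partialProdRatio hxden).comp (analyticAt_zTuple _ (havoid hx))
  · rw [fderiv_burgersIntegral₂ _ _ hone (hden 0), fderiv_zTuple_single_zero _ hone, zTuple_one,
      map_smul, fderiv_partialProdRatio_single_zero (hcoeff 0)]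
    norm_num
  · exact fderiv_burgersIntegral₂_single_last_ne_zero hN hα 0 0 (mem_avoidingTuples.1 hx₁)
      (havoid hx.1) hx.2

theorem isFirstIntegral₂_burgersIntegral₂ {N : ℕ} {α : ℂ} (hα : α ^ N = -1) :
    IsFirstIntegral₂ (burgersSolutions α) (N + 1) (burgersIntegral₂ N α) := by
  obtain ⟨hN, h0⟩ := ne_zero_of_pow_eq_neg_one hα
  refine ⟨_, isFamilyOfOrder_burgersIntegral₂ hN h0, fun u hu n m hx hy => ?_⟩
  have hx := mem_avoidingTuples.1 hx.1
  have hy := mem_avoidingTuples.1 hy.1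
  exact partialProdRatio_columns hα n (a := fun i => u n (m + i)) (b := fun i => u (n + 1) (m + i))
    (fun i => by simpa [add_assoc] using hu n (m + i))
    (fun i hi h => hx ⟨i, by lia⟩ (Or.inl h)) (fun i hi h => hx ⟨i, by lia⟩ (Or.inr h))
    (fun i hi h => hy ⟨i, by lia⟩ (Or.inr h))

section LinearEquation

theorem exists_int_chain {T : Type*} {F : ℤ → T → T → Prop} (hup : ∀ n x, ∃ y, F n x y)
    (hdown : ∀ n y, ∃ x, F n x y) (a : ℤ) (x₀ : T) :
    ∃ s : ℤ → T, s a = x₀ ∧ ∀ n, F n (s n) (s (n + 1)) := by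
  choose up hup using hup
  choose down hdown using hdown
  let s (n : ℤ) : T :=
    n.inductionOn' a x₀ (fun k _ x => up k x) fun k _ y => down (k - 1) y
  refine ⟨s, Int.inductionOn'_self, fun n => ?_⟩
  rcases le_or_gt a n with h | h
  · have hs : s (n + 1) = up n (s n) := Int.inductionOn'_add_one h
    exact hs ▸ hup n (s n)
  · have hs : s (n + 1 - 1) = down (n + 1 - 1) (s (n + 1)) :=
      Int.inductionOn'_sub_one (Int.add_one_le_of_lt h)
    rw [add_sub_cancel_right] at hs
    exact hs ▸ hdown n (s (n + 1))

/-- The solutions `v` of the linear lattice equation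
`v_{n+1,m+1} + v_{n,m+1} = αⁿ (v_{n+1,m} - v_{n,m})`, which the discrete Hopf–Cole transformation
relates to the Burgers-type equation. -/
def linearSolutions (α : ℂ) : Submodule ℂ (ℤ → ℤ → ℂ) where
  carrier := {v | ∀ n m : ℤ, v (n + 1) (m + 1) + v n (m + 1) = α ^ n * (v (n + 1) m - v n m)}
  add_mem' hv hw n m := by
    simp only [Pi.add_apply]
    linear_combination hv n m + hw n m
  zero_mem' n m := by simp
  smul_mem' c v hv n m := by
    simp only [Pi.smul_apply, smul_eq_mul]
    linear_combination c * hv n m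

theorem isClosed_linearSolutions (α : ℂ) : IsClosed (linearSolutions α : Set (ℤ → ℤ → ℂ)) := by
  simp only [linearSolutions, Submodule.coe_set_mk, AddSubmonoid.coe_set_mk,
    AddSubsemigroup.coe_set_mk, Set.ofPred_forall]
  exact isClosed_iInter fun n => isClosed_iInter fun m =>
    isClosed_eq (by fun_prop) (by fun_prop)

theorem exists_next_row (α : ℂ) (f : ℤ → ℂ) (n₀ : ℤ) (y : ℂ) :
    ∃ g : ℤ → ℂ, g n₀ = y ∧ ∀ n : ℤ, g (n + 1) + g n = α ^ n * (f (n + 1) - f n) :=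
  exists_int_chain (F := fun n x y => y + x = α ^ n * (f (n + 1) - f n))
    (fun _ _ => ⟨_, sub_add_cancel _ _⟩) (fun _ _ => ⟨_, add_sub_cancel _ _⟩) n₀ y

theorem exists_previous_row {α : ℂ} (hα : α ≠ 0) (g : ℤ → ℂ) (n₀ : ℤ) (x : ℂ) :
    ∃ f : ℤ → ℂ, f n₀ = x ∧ ∀ n : ℤ, g (n + 1) + g n = α ^ n * (f (n + 1) - f n) :=
  exists_int_chain (F := fun n x y => g (n + 1) + g n = α ^ n * (y - x))
    (fun n x => ⟨(g (n + 1) + g n) / α ^ n + x, by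
      rw [add_sub_cancel_right, mul_div_cancel₀ _ (zpow_ne_zero n hα)]⟩)
    (fun n y => ⟨y - (g (n + 1) + g n) / α ^ n, by
      rw [sub_sub_cancel, mul_div_cancel₀ _ (zpow_ne_zero n hα)]⟩) n₀ x

theorem exists_linearSolution {α : ℂ} (hα : α ≠ 0) (n₀ m₀ : ℤ) {row col : ℤ → ℂ}
    (h : row n₀ = col m₀) :
    ∃ v ∈ linearSolutions α, (∀ n, v n m₀ = row n) ∧ ∀ m, v n₀ m = col m := by
  obtain ⟨s, hs₀, hs⟩ := exists_int_chain (T := ℤ → ℂ)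
    (F := fun m f g => g n₀ = f n₀ + (col (m + 1) - col m) ∧
      ∀ n : ℤ, g (n + 1) + g n = α ^ n * (f (n + 1) - f n))
    (fun _ f => exists_next_row α f n₀ _)
    (fun m g => (exists_previous_row hα g n₀ (g n₀ - (col (m + 1) - col m))).imp
      fun _ hf => ⟨(sub_eq_iff_eq_add.1 hf.1.symm), hf.2⟩) m₀ row
  refine ⟨fun n m => s m n, fun n m => (hs m).2 n, fun n => congrFun hs₀ n,
    fun m => show s m n₀ = col m from ?_⟩
  induction m using Int.inductionOn' (b := m₀) with
  | zero => rw [hs₀, h]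
  | succ m _ ih => rw [(hs m).1, ih, add_sub_cancel]
  | pred m _ ih =>
    have hstep := (hs (m - 1)).1
    rw [sub_add_cancel, ih] at hstep
    linear_combination -hstep

theorem continuous_linearSolutions_apply (α : ℂ) (n m : ℤ) :
    Continuous fun v : linearSolutions α => v.1 n m :=
  (continuous_apply_apply n m).comp continuous_subtype_val

theorem dense_linearSolutions_ne_zero {α : ℂ} (hα : α ≠ 0) :
    Dense {v : linearSolutions α | ∀ n m, v.1 n m ≠ 0} := by
  have : TopologicalSpace.IsCompletelyPseudoMetrizableSpace (linearSolutions α) :=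
    (isClosed_linearSolutions α).isClosedEmbedding_subtypeVal.IsCompletelyPseudoMetrizableSpace
  let ev (p : ℤ × ℤ) : linearSolutions α →L[ℂ] ℂ :=
    { toFun := fun v => v.1 p.1 p.2
      map_add' := fun _ _ => rfl
      map_smul' := fun _ _ => rfl
      cont := continuous_linearSolutions_apply α p.1 p.2 }
  have hev (p : ℤ × ℤ) : ev p ≠ 0 := fun hp => by
    obtain ⟨v, hv, hrow, -⟩ := exists_linearSolution hα p.1 p.2 (row := 1) (col := 1) rfl
    exact one_ne_zero ((hrow p.1).symm.trans (DFunLike.congr_fun hp ⟨v, hv⟩))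
  have hdense : Dense (⋂ p, ev p ⁻¹' {0}ᶜ) := dense_iInter_of_isOpen
    (fun p => isOpen_compl_singleton.preimage (ev p).continuous)
    (fun p => (dense_compl_singleton 0).preimage ((ev p).isOpenMap_of_ne_zero (hev p)))
  exact hdense.mono fun v hv n m => Set.mem_iInter.1 hv (n, m)

/-- The discrete Hopf–Cole transformation `u_{n,m} = v_{n+1,m} / v_{n,m}`. -/
noncomputable def hopfCole (v : ℤ → ℤ → ℂ) (n m : ℤ) : ℂ := v (n + 1) m / v n m

theorem hopfCole_mem_burgersSolutions {α : ℂ} (hα : α ≠ 0) {v : ℤ → ℤ → ℂ}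
    (hv : v ∈ linearSolutions α) (hne : ∀ n m, v n m ≠ 0) : hopfCole v ∈ burgersSolutions α := by
  intro n m
  have hleft := hv n m
  have hright := hv (n + 1) m
  rw [zpow_add_one₀ hα] at hright
  have h₁ := hne n m
  have h₂ := hne (n + 1) m
  have h₃ := hne n (m + 1)
  have h₄ := hne (n + 1) (m + 1)
  simp only [hopfCole]
  field_simp
  linear_combination (v (n + 1) m - v n m) * hright -
    α * (v (n + 1 + 1) m - v (n + 1) m) * hleft

theorem eq_of_dense_of_eventually_eq {E T : Type*} [TopologicalSpace E] [TopologicalSpace T]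
    [T2Space T] {s : Set E} (hs : Dense s) {f g : E → T} {x : E} (hf : ContinuousAt f x)
    (hg : ContinuousAt g x) (h : ∀ᶠ y in 𝓝 x, y ∈ s → f y = g y) : f x = g x :=
  have : (𝓝[s] x).NeBot := mem_closure_iff_nhdsWithin_neBot.1 (hs x)
  tendsto_nhds_unique_of_eventuallyEq (hf.tendsto.mono_left nhdsWithin_le_nhds)
    (hg.tendsto.mono_left nhdsWithin_le_nhds) (eventually_nhdsWithin_iff.2 h)

theorem continuousAt_hopfCole {α : ℂ} {n m : ℤ} {v : linearSolutions α} (h : v.1 n m ≠ 0) :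
    ContinuousAt (fun v : linearSolutions α => hopfCole v.1 n m) v :=
  (continuous_linearSolutions_apply α _ _).continuousAt.div
    (continuous_linearSolutions_apply α _ _).continuousAt h

/-- Solutions without zeros are dense, so a relation between values of `u`, although it is only
assumed where `u` solves the Burgers-type equation everywhere, may be used for `u = hopfCole v` as
soon as the finitely many values of `u` in it are defined. -/
theorem hopfCole_eq_of_forall_mem_burgersSolutions {α : ℂ} (hα : α ≠ 0) {ι : Type*}
    {P Q : ι → ℤ × ℤ} {D D' : Set (ι → ℂ)} (hD : IsOpen D) (hD' : IsOpen D') {w w' : (ι → ℂ) → ℂ}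
    (hw : ContinuousOn w D) (hw' : ContinuousOn w' D')
    (h : ∀ u ∈ burgersSolutions α, (fun i => u (P i).1 (P i).2) ∈ D →
      (fun i => u (Q i).1 (Q i).2) ∈ D' →
      w' (fun i => u (Q i).1 (Q i).2) = w (fun i => u (P i).1 (P i).2))
    {v : ℤ → ℤ → ℂ} (hv : v ∈ linearSolutions α)
    (hvP : ∀ i, v (P i).1 (P i).2 ≠ 0) (hvQ : ∀ i, v (Q i).1 (Q i).2 ≠ 0)
    (hPD : (fun i => hopfCole v (P i).1 (P i).2) ∈ D)
    (hQD : (fun i => hopfCole v (Q i).1 (Q i).2) ∈ D') :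
    w' (fun i => hopfCole v (Q i).1 (Q i).2) = w (fun i => hopfCole v (P i).1 (P i).2) := by
  let tuple (R : ι → ℤ × ℤ) (v : linearSolutions α) (i : ι) : ℂ := hopfCole v.1 (R i).1 (R i).2
  have hP : ContinuousAt (tuple P) ⟨v, hv⟩ :=
    continuousAt_pi.2 fun i => continuousAt_hopfCole (hvP i)
  have hQ : ContinuousAt (tuple Q) ⟨v, hv⟩ :=
    continuousAt_pi.2 fun i => continuousAt_hopfCole (hvQ i)
  refine eq_of_dense_of_eventually_eq (dense_linearSolutions_ne_zero hα) (x := ⟨v, hv⟩)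
    (f := w' ∘ tuple Q) (g := w ∘ tuple P)
    ((hw'.continuousAt (hD'.mem_nhds hQD)).comp hQ) ((hw.continuousAt (hD.mem_nhds hPD)).comp hP) ?_
  filter_upwards [hP.eventually (hD.mem_nhds hPD), hQ.eventually (hD'.mem_nhds hQD)]
    with x hxD hxD' hx
  exact h _ (hopfCole_mem_burgersSolutions hα x.2 hx) hxD hxD'

end LinearEquation

section ShiftRelation

variable {𝕜 : Type*} [NontriviallyNormedField 𝕜] {k : ℕ} {a b c γ : 𝕜}

/-- The pairs of tuples `p`, `q` with `q_{i+1} - b qᵢ = c γⁱ (p_{i+1} + a pᵢ)`. Both the rows and,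
after passing to a potential, the columns of `linearSolutions` are linked in this way. -/
def shiftRelation (k : ℕ) (a b c γ : 𝕜) : Submodule 𝕜 ((Fin (k + 2) → 𝕜) × (Fin (k + 2) → 𝕜)) where
  carrier := {r | ∀ i : Fin (k + 1),
    r.2 i.succ - b * r.2 i.castSucc = c * γ ^ (i : ℕ) * (r.1 i.succ + a * r.1 i.castSucc)}
  add_mem' h h' i := by
    simp only [Prod.fst_add, Prod.snd_add, Pi.add_apply]
    linear_combination h i + h' i
  zero_mem' i := by simp
  smul_mem' t r h i := by
    simp only [Prod.smul_fst, Prod.smul_snd, Pi.smul_apply, smul_eq_mul]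
    linear_combination t * h i

theorem exists_first_order_recurrence {n : ℕ} (b h : Fin n → 𝕜) :
    ∃ q : Fin (n + 1) → 𝕜, ∀ i, q i.succ = b i * q i.castSucc + h i :=
  ⟨Fin.induction 0 fun i x => b i * x + h i, Fin.induction_succ _ _⟩

theorem exists_mem_shiftRelation_right (p : Fin (k + 2) → 𝕜) :
    ∃ q, (p, q) ∈ shiftRelation k a b c γ := by
  obtain ⟨q, hq⟩ := exists_first_order_recurrence (fun _ => b)
    fun i : Fin (k + 1) => c * γ ^ (i : ℕ) * (p i.succ + a * p i.castSucc)
  exact ⟨q, fun i => sub_eq_iff_eq_add'.2 (hq i)⟩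

theorem exists_mem_shiftRelation_left (hc : c ≠ 0) (hγ : γ ≠ 0) (q : Fin (k + 2) → 𝕜) :
    ∃ p, (p, q) ∈ shiftRelation k a b c γ := by
  obtain ⟨p, hp⟩ := exists_first_order_recurrence (fun _ => -a)
    fun i : Fin (k + 1) => (q i.succ - b * q i.castSucc) / (c * γ ^ (i : ℕ))
  refine ⟨p, fun i => ?_⟩
  change q i.succ - b * q i.castSucc = c * γ ^ (i : ℕ) * (p i.succ + a * p i.castSucc)
  rw [hp, add_right_comm, neg_mul, neg_add_cancel, zero_add,
    mul_div_cancel₀ _ (mul_ne_zero hc (pow_ne_zero _ hγ))]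

theorem dense_snd_shiftRelation [CompleteSpace 𝕜] (hc : c ≠ 0) (hγ : γ ≠ 0)
    {Ω Ω' : Set (Fin (k + 2) → 𝕜)} (hΩ : IsOpen Ω) (hΩd : Dense Ω) (hΩd' : Dense Ω') :
    Dense {q | ∃ p, (p, q) ∈ shiftRelation k a b c γ ∧ p ∈ Ω ∧ q ∈ Ω'} := by
  let π₁ : shiftRelation k a b c γ →ₗ[𝕜] (Fin (k + 2) → 𝕜) := .fst _ _ _ ∘ₗ Submodule.subtype _
  let π₂ : shiftRelation k a b c γ →ₗ[𝕜] (Fin (k + 2) → 𝕜) := .snd _ _ _ ∘ₗ Submodule.subtype _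
  have hπ₁ : Function.Surjective π₁ := fun p =>
    (exists_mem_shiftRelation_right p).elim fun q hq => ⟨⟨(p, q), hq⟩, rfl⟩
  have hπ₂ : Function.Surjective π₂ := fun q =>
    (exists_mem_shiftRelation_left hc hγ q).elim fun p hp => ⟨⟨(p, q), hp⟩, rfl⟩
  have hdense : Dense (π₁ ⁻¹' Ω ∩ π₂ ⁻¹' Ω') :=
    (hΩd.preimage (π₁.isOpenMap_of_finiteDimensional hπ₁)).inter_of_isOpen_left
      (hΩd'.preimage (π₂.isOpenMap_of_finiteDimensional hπ₂))
      (hΩ.preimage π₁.continuous_of_finiteDimensional)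
  refine (hπ₂.denseRange.dense_image π₂.continuous_of_finiteDimensional hdense).mono ?_
  rintro _ ⟨r, ⟨hr, hr'⟩, rfl⟩
  exact ⟨π₁ r, r.2, hr, hr'⟩

theorem geom_mem_shiftRelation {μ x y : 𝕜} (h : y * (γ * μ - b) = c * (x * (μ + a))) :
    (x • fun i : Fin (k + 2) => μ ^ (i : ℕ), y • fun i : Fin (k + 2) => (γ * μ) ^ (i : ℕ)) ∈
      shiftRelation k a b c γ := by
  intro i
  simp only [Pi.smul_apply, smul_eq_mul, Fin.val_succ, Fin.val_castSucc, pow_succ, mul_pow]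
  linear_combination γ ^ (i : ℕ) * μ ^ (i : ℕ) * h

theorem fderiv_eq_of_eq_on_submodule {E : Type*} [NormedAddCommGroup E] [NormedSpace 𝕜 E]
    {R : Submodule 𝕜 (E × E)} {Ω Ω' : Set E} (hΩ : IsOpen Ω) (hΩ' : IsOpen Ω') {W W' : E → 𝕜}
    (h : ∀ p q, (p, q) ∈ R → p ∈ Ω → q ∈ Ω' → W' q = W p) {p q x y : E} (hp : p ∈ Ω)
    (hq : q ∈ Ω') (hW : DifferentiableAt 𝕜 W p) (hW' : DifferentiableAt 𝕜 W' q)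
    (hpq : (p, q) ∈ R) (hxy : (x, y) ∈ R) : fderiv 𝕜 W' q y = fderiv 𝕜 W p x := by
  have hline {z v : E} {O : Set E} (hO : IsOpen O) (hz : z ∈ O) :
      ∀ᶠ t : 𝕜 in 𝓝 0, z + t • v ∈ O := by
    have hcont : Continuous fun t : 𝕜 => z + t • v := by fun_prop
    exact hcont.continuousAt.eventually (hO.mem_nhds (by simpa using hz))
  rw [← hW.lineDeriv_eq_fderiv, ← hW'.lineDeriv_eq_fderiv]
  refine EventuallyEq.deriv_eq ?_
  filter_upwards [hline hΩ hp, hline hΩ' hq] with t hpt hqt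
  exact h _ _ (R.add_mem hpq (R.smul_mem t hxy)) hpt hqt

theorem fderiv_geom_eq_zero_of_shiftRelation [CompleteSpace 𝕜] (hc : c ≠ 0) (hγ : γ ≠ 0)
    {Ω Ω' : Set (Fin (k + 2) → 𝕜)} (hΩ : IsOpen Ω) (hΩd : Dense Ω) (hΩ' : IsOpen Ω')
    (hΩd' : Dense Ω') {W W' : (Fin (k + 2) → 𝕜) → 𝕜} (hW : AnalyticOnNhd 𝕜 W Ω)
    (hW' : AnalyticOnNhd 𝕜 W' Ω')
    (h : ∀ p q, (p, q) ∈ shiftRelation k a b c γ → p ∈ Ω → q ∈ Ω' → W' q = W p) {μ x y : 𝕜}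
    (hy : y ≠ 0) (hxy : y * (γ * μ - b) = c * (x * (μ + a)))
    (hx : ∀ p ∈ Ω, x * fderiv 𝕜 W p (fun i => μ ^ (i : ℕ)) = 0) :
    ∀ q ∈ Ω', fderiv 𝕜 W' q (fun i => (γ * μ) ^ (i : ℕ)) = 0 := by
  intro q hq
  refine eq_of_dense_of_eventually_eq (dense_snd_shiftRelation (a := a) (b := b) hc hγ hΩ hΩd hΩd')
    ((hW'.fderiv q hq).continuousAt.clm_apply continuousAt_const)
    (continuousAt_const (y := (0 : 𝕜))) (Eventually.of_forall ?_)
  rintro q' ⟨p, hpq, hp, hq'⟩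
  have hderiv := fderiv_eq_of_eq_on_submodule hΩ hΩ' h hp hq' (hW p hp).differentiableAt
    (hW' q' hq').differentiableAt hpq (geom_mem_shiftRelation hxy)
  rw [map_smul, map_smul, smul_eq_mul, smul_eq_mul, hx p hp] at hderiv
  exact (mul_eq_zero.1 hderiv).resolve_left hy

theorem eq_zero_of_forall_geom {n : ℕ} (L : (Fin n → 𝕜) →L[𝕜] 𝕜) {f : Fin n → 𝕜}
    (hf : Function.Injective f) (h : ∀ j, L (fun i => f j ^ (i : ℕ)) = 0) : L = 0 := by
  have hL (x : Fin n → 𝕜) : L x = ∑ i, x i * L (Pi.single i 1) := by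
    conv_lhs => rw [pi_eq_sum_univ' x]
    simp
  have hzero := Matrix.eq_zero_of_forall_index_sum_pow_mul_eq_zero hf fun j =>
    (hL _).symm.trans (h j)
  ext1 x
  rw [hL]
  simp [congrFun hzero]

/-- Transferring `n ↦ μⁿ` from one relation to the next multiplies its ratio by `γ`, and the ratio
`β (s + 1)` is annihilated after the `s`-th relation; so the derivatives vanish on the geometric
sequences with the ratios `γ^j β(s - j)`, which span. -/
theorem fderiv_eq_zero_of_shiftRelation_chain [CompleteSpace 𝕜] {β : ℤ → 𝕜} (hc : c ≠ 0)
    (hγ : γ ≠ 0) (hβ : ∀ s : ℤ, ∀ j : ℕ, j ≤ k → γ ^ j * β (s - j) ≠ -β s)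
    (hinj : ∀ s : ℤ, Function.Injective fun j : Fin (k + 2) => γ ^ (j : ℕ) * β (s - (j : ℕ)))
    {Ω : ℤ → Set (Fin (k + 2) → 𝕜)} (hΩ : ∀ s, IsOpen (Ω s)) (hΩd : ∀ s, Dense (Ω s))
    {W : ℤ → (Fin (k + 2) → 𝕜) → 𝕜} (hW : ∀ s, AnalyticOnNhd 𝕜 (W s) (Ω s))
    (h : ∀ s p q, (p, q) ∈ shiftRelation k (β s) (β (s + 1)) c γ → p ∈ Ω s → q ∈ Ω (s + 1) →
      W (s + 1) q = W s p) (s : ℤ) {p : Fin (k + 2) → 𝕜} (hp : p ∈ Ω s) :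
    fderiv 𝕜 (W s) p = 0 := by
  have hgeom : ∀ j : ℕ, j ≤ k + 1 → ∀ s, ∀ p ∈ Ω s,
      fderiv 𝕜 (W s) p (fun i => (γ ^ j * β (s - j)) ^ (i : ℕ)) = 0 := by
    intro j hj s
    obtain ⟨s, rfl⟩ : ∃ r, s = r + 1 := ⟨s - 1, (sub_add_cancel s 1).symm⟩
    induction j generalizing s with
    | zero =>
      have hμ : γ * (γ⁻¹ * β (s + 1)) = β (s + 1) := mul_inv_cancel_left₀ hγ _
      simpa [hμ] using fderiv_geom_eq_zero_of_shiftRelation hc hγ (hΩ s) (hΩd s) (hΩ _) (hΩd _)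
        (hW s) (hW _) (h s) (μ := γ⁻¹ * β (s + 1)) (x := 0) (y := 1) one_ne_zero
        (by simp [hμ]) (by simp)
    | succ j ih =>
      have hratio : γ ^ (j + 1) * β (s + 1 - ((j + 1 : ℕ) : ℤ)) = γ * (γ ^ j * β (s - j)) := by
        rw [pow_succ', mul_assoc, Nat.cast_add_one, add_sub_add_right_eq_sub]
      have hne : γ ^ j * β (s - j) + β s ≠ 0 := fun h0 =>
        hβ s j (by lia) (eq_neg_of_add_eq_zero_left h0)
      rw [hratio]
      refine fderiv_geom_eq_zero_of_shiftRelation hc hγ (hΩ s) (hΩd s) (hΩ _) (hΩd _)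
        (hW s) (hW _) (h s) (x := γ * (γ ^ j * β (s - j)) - β (s + 1)) (mul_ne_zero hc hne)
        (by ring) fun p hp => ?_
      obtain ⟨s, rfl⟩ : ∃ r, s = r + 1 := ⟨s - 1, (sub_add_cancel s 1).symm⟩
      rw [ih (by lia) s p hp, mul_zero]
  exact eq_zero_of_forall_geom _ (hinj s) fun j => hgeom j (by lia) s p hp

end ShiftRelation

section Submersions

variable {𝕜 : Type*} [NontriviallyNormedField 𝕜] {E F G : Type*}
  [NormedAddCommGroup E] [NormedSpace 𝕜 E] [NormedAddCommGroup F] [NormedSpace 𝕜 F]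
  [NormedAddCommGroup G] [NormedSpace 𝕜 G]

/-- `r` is an analytic submersion from the dense open set `U` onto a dense set: the changes of
variables along which the vanishing of a derivative descends. -/
structure IsDenseSubmersion (𝕜 : Type*) [NontriviallyNormedField 𝕜] {E F : Type*}
    [NormedAddCommGroup E] [NormedSpace 𝕜 E] [NormedAddCommGroup F] [NormedSpace 𝕜 F]
    (r : E → F) (U : Set E) : Prop where
  isOpen : IsOpen U
  dense : Dense U
  analyticOnNhd : AnalyticOnNhd 𝕜 r U
  surjective_fderiv : ∀ p ∈ U, Function.Surjective (fderiv 𝕜 r p)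
  dense_image : Dense (r '' U)

namespace IsDenseSubmersion

variable {r : E → F} {U : Set E} {V : Set F}

theorem isOpen_inter_preimage (hr : IsDenseSubmersion 𝕜 r U) (hV : IsOpen V) :
    IsOpen (U ∩ r ⁻¹' V) :=
  hr.analyticOnNhd.continuousOn.isOpen_inter_preimage hr.isOpen hV

theorem dense_inter_preimage [CompleteSpace 𝕜] [CompleteSpace E] [CompleteSpace F]
    (hr : IsDenseSubmersion 𝕜 r U) (hV : Dense V) : Dense (U ∩ r ⁻¹' V) := by
  refine dense_iff_inter_open.2 fun O hO hne => ?_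
  obtain ⟨p, hpO, hpU⟩ := hr.dense.inter_open_nonempty O hO hne
  have hmap : map r (𝓝 p) = 𝓝 (r p) :=
    (hr.analyticOnNhd p hpU).hasStrictFDerivAt.map_nhds_eq_of_surj
      (LinearMap.range_eq_top.2 (hr.surjective_fderiv p hpU))
  have himage : r '' (O ∩ U) ∈ 𝓝 (r p) :=
    hmap ▸ image_mem_map ((hO.inter hr.isOpen).mem_nhds ⟨hpO, hpU⟩)
  obtain ⟨_, ⟨q, ⟨hqO, hqU⟩, rfl⟩, hqV⟩ := mem_closure_iff_nhds.1 (hV (r p)) _ himage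
  exact ⟨q, hqO, hqU, hqV⟩

theorem comp [CompleteSpace 𝕜] [CompleteSpace E] [CompleteSpace F] {g : F → G}
    (hg : IsDenseSubmersion 𝕜 g V) (hr : IsDenseSubmersion 𝕜 r U) :
    IsDenseSubmersion 𝕜 (g ∘ r) (U ∩ r ⁻¹' V) where
  isOpen := hr.isOpen_inter_preimage hg.isOpen
  dense := hr.dense_inter_preimage hg.dense
  analyticOnNhd p hp := (hg.analyticOnNhd _ hp.2).comp (hr.analyticOnNhd p hp.1)
  surjective_fderiv p hp := by
    rw [fderiv_comp p (hg.analyticOnNhd _ hp.2).differentiableAt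
      (hr.analyticOnNhd p hp.1).differentiableAt]
    exact (hg.surjective_fderiv _ hp.2).comp (hr.surjective_fderiv p hp.1)
  dense_image := by
    refine dense_iff_inter_open.2 fun O hO hne => ?_
    obtain ⟨_, hyO, y, hyV, rfl⟩ := hg.dense_image.inter_open_nonempty O hO hne
    obtain ⟨_, ⟨hV, hgO⟩, p, hpU, rfl⟩ := hr.dense_image.inter_open_nonempty _
      (hg.isOpen_inter_preimage hO) ⟨y, hyV, hyO⟩
    exact ⟨g (r p), hgO, p, ⟨hpU, hV⟩, rfl⟩

theorem fderiv_eq_zero_of_comp [CompleteSpace 𝕜] [CompleteSpace F] [CompleteSpace G]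
    (hr : IsDenseSubmersion 𝕜 r U) (hV : IsOpen V) {w : F → G} (hw : AnalyticOnNhd 𝕜 w V)
    (h : ∀ p ∈ U ∩ r ⁻¹' V, fderiv 𝕜 (w ∘ r) p = 0) {x : F} (hx : x ∈ V) :
    fderiv 𝕜 w x = 0 := by
  refine eq_of_dense_of_eventually_eq hr.dense_image (hw.fderiv x hx).continuousAt
    (continuousAt_const (y := (0 : F →L[𝕜] G))) ?_
  filter_upwards [hV.mem_nhds hx]
  rintro _ hpV ⟨p, hpU, rfl⟩
  have hzero := h p ⟨hpU, hpV⟩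
  rw [fderiv_comp p (hw _ hpV).differentiableAt (hr.analyticOnNhd p hpU).differentiableAt] at hzero
  ext y
  obtain ⟨z, rfl⟩ := hr.surjective_fderiv p hpU y
  exact DFunLike.congr_fun hzero z

end IsDenseSubmersion

end Submersions

section RatioTuple

variable {k : ℕ}

/-- The ratios `p_{i+1} / pᵢ` of consecutive entries, in which `hopfCole` is expressed. -/
noncomputable def ratioTuple (p : Fin (k + 2) → ℂ) : Fin (k + 1) → ℂ :=
  fun i => p i.succ / p i.castSucc

theorem analyticAt_ratioTuple {p : Fin (k + 2) → ℂ} (hp : ∀ i, p i ≠ 0) :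
    AnalyticAt ℂ ratioTuple p :=
  AnalyticAt.pi fun i => (analyticAt_pi_apply i.succ p).div (analyticAt_pi_apply i.castSucc p)
    (hp i.castSucc)

theorem fderiv_ratioTuple_apply {p : Fin (k + 2) → ℂ} (hp : ∀ i, p i ≠ 0) (v : Fin (k + 2) → ℂ)
    (i : Fin (k + 1)) : fderiv ℂ ratioTuple p v i =
      (v i.succ * p i.castSucc - p i.succ * v i.castSucc) / p i.castSucc ^ 2 := by
  have hentry (j : Fin (k + 1)) : HasDerivAt (fun t : ℂ => ratioTuple (p + t • v) j) _ 0 :=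
    (hasDerivAt_add_smul_apply p v j.succ).div (hasDerivAt_add_smul_apply p v j.castSucc)
      (by simpa using hp j.castSucc)
  rw [← (analyticAt_ratioTuple hp).differentiableAt.lineDeriv_eq_fderiv, lineDeriv,
    deriv_pi fun j => (hentry j).differentiableAt]
  simpa using (hentry i).deriv

theorem surjective_fderiv_ratioTuple {p : Fin (k + 2) → ℂ} (hp : ∀ i, p i ≠ 0) :
    Function.Surjective (fderiv ℂ (ratioTuple (k := k)) p) := by
  intro y
  obtain ⟨v, hv⟩ := exists_first_order_recurrence (fun i : Fin (k + 1) => p i.succ / p i.castSucc)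
    fun i => p i.castSucc * y i
  refine ⟨v, funext fun i => ?_⟩
  have hpi := hp i.castSucc
  rw [fderiv_ratioTuple_apply hp, hv]
  field_simp
  ring

theorem exists_ratioTuple_eq {t : Fin (k + 1) → ℂ} (ht : ∀ i, t i ≠ 0) :
    ∃ p : Fin (k + 2) → ℂ, (∀ i, p i ≠ 0) ∧ ratioTuple p = t := by
  have hne (i : Fin (k + 2)) : Fin.partialProd t i ≠ 0 := by
    induction i using Fin.induction with
    | zero => simp
    | succ i ih => rw [Fin.partialProd_succ]; exact mul_ne_zero ih (ht i)
  refine ⟨Fin.partialProd t, hne, funext fun i => ?_⟩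
  rw [ratioTuple, Fin.partialProd_succ, mul_div_cancel_left₀ _ (hne _)]

theorem isDenseSubmersion_ratioTuple :
    IsDenseSubmersion ℂ (ratioTuple (k := k)) (avoidingTuples _ {0}) where
  isOpen := isOpen_avoidingTuples (Set.finite_singleton 0)
  dense := dense_avoidingTuples (Set.finite_singleton 0)
  analyticOnNhd _ hp := analyticAt_ratioTuple (mem_avoidingTuples.1 hp)
  surjective_fderiv _ hp := surjective_fderiv_ratioTuple (mem_avoidingTuples.1 hp)
  dense_image := (dense_avoidingTuples (Set.finite_singleton 0)).mono fun t ht => by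
    obtain ⟨p, hp, rfl⟩ := exists_ratioTuple_eq (t := t) (mem_avoidingTuples.1 ht)
    exact ⟨p, mem_avoidingTuples.2 hp, rfl⟩

end RatioTuple

section CayleyTuple

variable {k : ℕ} {c : ℂ}

/-- The entrywise Cayley transform `t ↦ -(t + c) / (t - c)`. It is inverse to
`u ↦ c (u - 1) / (u + 1)`, and expresses a column of `hopfCole` by the ratios of a potential. -/
noncomputable def cayleyTuple (c : ℂ) (t : Fin (k + 1) → ℂ) : Fin (k + 1) → ℂ :=
  fun i => -(t i + c) / (t i - c)

theorem analyticAt_cayleyTuple {t : Fin (k + 1) → ℂ} (ht : ∀ i, t i ≠ c) :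
    AnalyticAt ℂ (cayleyTuple c) t :=
  AnalyticAt.pi fun i => ((analyticAt_pi_apply i t).add analyticAt_const).neg.div
    ((analyticAt_pi_apply i t).sub analyticAt_const) (sub_ne_zero.2 (ht i))

theorem fderiv_cayleyTuple_apply {t : Fin (k + 1) → ℂ} (ht : ∀ i, t i ≠ c) (v : Fin (k + 1) → ℂ)
    (i : Fin (k + 1)) : fderiv ℂ (cayleyTuple c) t v i = 2 * c / (t i - c) ^ 2 * v i := by
  have hentry (j : Fin (k + 1)) : HasDerivAt (fun s : ℂ => cayleyTuple c (t + s • v) j) _ 0 :=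
    ((hasDerivAt_add_smul_apply t v j).add_const c).neg.div
      ((hasDerivAt_add_smul_apply t v j).sub_const c) (by simpa [sub_eq_zero] using ht j)
  rw [← (analyticAt_cayleyTuple ht).differentiableAt.lineDeriv_eq_fderiv, lineDeriv,
    deriv_pi fun j => (hentry j).differentiableAt]
  refine (hentry i).deriv.trans ?_
  simp only [zero_smul, add_zero, Pi.neg_apply]
  ring

theorem surjective_fderiv_cayleyTuple (hc : c ≠ 0) {t : Fin (k + 1) → ℂ} (ht : ∀ i, t i ≠ c) :
    Function.Surjective (fderiv ℂ (cayleyTuple c) t) := by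
  intro y
  refine ⟨fun i => (t i - c) ^ 2 / (2 * c) * y i, funext fun i => ?_⟩
  have hti := sub_ne_zero.2 (ht i)
  rw [fderiv_cayleyTuple_apply ht]
  field_simp

theorem exists_cayleyTuple_eq (hc : c ≠ 0) {u : Fin (k + 1) → ℂ} (hu : ∀ i, u i ≠ -1) :
    ∃ t : Fin (k + 1) → ℂ, (∀ i, t i ≠ c) ∧ cayleyTuple c t = u := by
  have hu' (i : Fin (k + 1)) : u i + 1 ≠ 0 := fun h => hu i (eq_neg_of_add_eq_zero_left h)
  have hsub (i : Fin (k + 1)) : c * (u i - 1) / (u i + 1) - c = -(2 * c) / (u i + 1) := by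
    have := hu' i
    field_simp
    ring
  refine ⟨fun i => c * (u i - 1) / (u i + 1), fun i h => ?_, funext fun i => ?_⟩
  · rw [← sub_eq_zero, hsub] at h
    simp [hc, hu' i] at h
  · have := hu' i
    rw [cayleyTuple, hsub]
    field_simp
    ring

theorem isDenseSubmersion_cayleyTuple (hc : c ≠ 0) :
    IsDenseSubmersion ℂ (cayleyTuple (k := k) c) (avoidingTuples _ {c}) where
  isOpen := isOpen_avoidingTuples (Set.finite_singleton c)
  dense := dense_avoidingTuples (Set.finite_singleton c)
  analyticOnNhd _ ht := analyticAt_cayleyTuple (mem_avoidingTuples.1 ht)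
  surjective_fderiv _ ht := surjective_fderiv_cayleyTuple hc (mem_avoidingTuples.1 ht)
  dense_image := (dense_avoidingTuples (Set.finite_singleton (-1))).mono fun u hu => by
    obtain ⟨t, ht, rfl⟩ := exists_cayleyTuple_eq hc (u := u) (mem_avoidingTuples.1 hu)
    exact ⟨t, mem_avoidingTuples.2 ht, rfl⟩

end CayleyTuple

theorem fderiv_eq_zero_of_shiftRelation_chain_comp {k : ℕ} {β : ℤ → ℂ} {c γ : ℂ} (hc : c ≠ 0)
    (hγ : γ ≠ 0) (hβ : ∀ s : ℤ, ∀ j : ℕ, j ≤ k → γ ^ j * β (s - j) ≠ -β s)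
    (hinj : ∀ s : ℤ, Function.Injective fun j : Fin (k + 2) => γ ^ (j : ℕ) * β (s - (j : ℕ)))
    {F : Type*} [NormedAddCommGroup F] [NormedSpace ℂ F] [CompleteSpace F]
    {r : ℤ → (Fin (k + 2) → ℂ) → F} {U : ℤ → Set (Fin (k + 2) → ℂ)}
    (hr : ∀ s, IsDenseSubmersion ℂ (r s) (U s)) {D : ℤ → Set F} (hD : ∀ s, IsOpen (D s))
    (hDd : ∀ s, Dense (D s)) {w : ℤ → F → ℂ} (hw : ∀ s, AnalyticOnNhd ℂ (w s) (D s))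
    (h : ∀ s p q, (p, q) ∈ shiftRelation k (β s) (β (s + 1)) c γ →
      p ∈ U s ∩ r s ⁻¹' D s → q ∈ U (s + 1) ∩ r (s + 1) ⁻¹' D (s + 1) →
      w (s + 1) (r (s + 1) q) = w s (r s p)) (s : ℤ) {x : F} (hx : x ∈ D s) :
    fderiv ℂ (w s) x = 0 :=
  (hr s).fderiv_eq_zero_of_comp (hD s) (hw s) (fun _ hp =>
    fderiv_eq_zero_of_shiftRelation_chain (W := fun s => w s ∘ r s) hc hγ hβ hinj
      (fun s => (hr s).isOpen_inter_preimage (hD s))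
      (fun s => (hr s).dense_inter_preimage (hDd s))
      (fun s _ hp => (hw s _ hp.2).comp ((hr s).analyticOnNhd _ hp.1)) h s hp) hx

section LowerBounds

variable {α : ℂ} {k : ℕ} {v : ℤ → ℤ → ℂ} {n m : ℤ} {p q : Fin (k + 2) → ℂ}

theorem exists_int_extension {T : Type*} [Inhabited T] {K : ℕ} (n : ℤ) (f : Fin K → T) :
    ∃ r : ℤ → T, ∀ i : Fin K, r (n + (i : ℕ)) = f i := by
  have hinj : Function.Injective fun i : Fin K => n + ((i : ℕ) : ℤ) := fun i j hij => by
    simpa [Fin.ext_iff] using hij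
  exact ⟨Function.extend _ f default, hinj.extend_apply f _⟩

theorem exists_linearSolution_rows (hα : α ≠ 0)
    (h : (p, q) ∈ shiftRelation k (-1) (-1) (α ^ n) α) :
    ∃ v ∈ linearSolutions α, (∀ i : Fin (k + 2), v (n + (i : ℕ)) m = p i) ∧
      ∀ i : Fin (k + 2), v (n + (i : ℕ)) (m + 1) = q i := by
  obtain ⟨row, hrow⟩ := exists_int_extension n p
  obtain ⟨col, hcol⟩ := exists_int_extension m ![p 0, q 0]
  have hcorner : row n = col m := by simpa using (hrow 0).trans (hcol 0).symm
  obtain ⟨v, hv, hvrow, hvcol⟩ := exists_linearSolution hα n m hcorner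
  have hp (i : Fin (k + 2)) : v (n + (i : ℕ)) m = p i := (hvrow _).trans (hrow i)
  refine ⟨v, hv, hp, fun i => ?_⟩
  induction i using Fin.induction with
  | zero => simpa using (hvcol _).trans (hcol 1)
  | succ i ih =>
    have hlin := hv (n + (i : ℕ)) m
    have hpi := hp i.castSucc
    have hpi' := hp i.succ
    simp only [Fin.val_castSucc, Fin.val_succ, Nat.cast_succ, ← add_assoc] at ih hpi hpi' ⊢
    rw [zpow_add₀ hα, zpow_natCast, ih, hpi, hpi'] at hlin
    linear_combination hlin - h i

/-- The tuple `p` is a common potential for the columns `n` and `n + 1` of `v`. Columns of solutions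
of the linear equation have potentials, and `shiftRelation` links those of successive columns. -/
def IsColumnPotential (α : ℂ) (v : ℤ → ℤ → ℂ) (n m : ℤ) (p : Fin (k + 2) → ℂ) : Prop :=
  ∀ i : Fin (k + 1), v n (m + (i : ℕ)) = p i.succ - α ^ n * p i.castSucc ∧
    v (n + 1) (m + (i : ℕ)) = -(p i.succ + α ^ n * p i.castSucc)

theorem isColumnPotential_of_mem_linearSolutions (hv : v ∈ linearSolutions α)
    (h : ∀ i : Fin (k + 1), v n (m + (i : ℕ)) = p i.succ - α ^ n * p i.castSucc)
    (h₀ : v (n + 1) m = -(p 1 + α ^ n * p 0)) : IsColumnPotential α v n m p := by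
  refine fun i => ⟨h i, ?_⟩
  induction i using Fin.induction with
  | zero => simpa using h₀
  | succ i ih =>
    have hlin := hv n (m + (i : ℕ))
    have hi := h i.castSucc
    have hi' := h i.succ
    simp only [Fin.val_castSucc, Fin.val_succ, Nat.cast_succ, ← add_assoc, Fin.succ_castSucc]
      at ih hi hi' ⊢
    linear_combination hlin - hi' + α ^ n * (ih - hi)

theorem exists_linearSolution_columns (hα : α ≠ 0)
    (h : (p, q) ∈ shiftRelation k (α ^ n) (α ^ (n + 1)) (-1) 1) :
    ∃ v ∈ linearSolutions α, IsColumnPotential α v n m p ∧ IsColumnPotential α v (n + 1) m q := by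
  obtain ⟨row, hrow⟩ := exists_int_extension n
    ![p 1 - α ^ n * p 0, -(p 1 + α ^ n * p 0), -(q 1 + α ^ (n + 1) * q 0)]
  obtain ⟨col, hcol⟩ := exists_int_extension m
    fun i : Fin (k + 1) => p i.succ - α ^ n * p i.castSucc
  have hcorner : row n = col m := by simpa using (hrow 0).trans (hcol 0).symm
  obtain ⟨v, hv, hvrow, hvcol⟩ := exists_linearSolution hα n m hcorner
  have hp := isColumnPotential_of_mem_linearSolutions (p := p) hv
    (fun i => (hvcol _).trans (hcol i)) (by simpa using (hvrow _).trans (hrow 1))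
  refine ⟨v, hv, hp, isColumnPotential_of_mem_linearSolutions hv (fun i => ?_)
    (by simpa [add_assoc] using (hvrow _).trans (hrow 2))⟩
  rw [(hp i).2]
  linear_combination -h i

theorem rowTuple_hopfCole (h : ∀ i : Fin (k + 2), v (n + (i : ℕ)) m = p i) :
    rowTuple (hopfCole v) k n m = ratioTuple p := by
  ext i
  rw [rowTuple, hopfCole, ratioTuple, ← h, ← h, Fin.val_castSucc, Fin.val_succ, Nat.cast_succ,
    add_assoc]

theorem IsColumnPotential.colTuple_hopfCole (h : IsColumnPotential α v n m p) (hp : ∀ i, p i ≠ 0) :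
    colTuple (hopfCole v) k n m = cayleyTuple (α ^ n) (ratioTuple p) := by
  ext i
  have hpi := hp i.castSucc
  have hnum : -(p i.succ + α ^ n * p i.castSucc) =
      p i.castSucc * -(p i.succ / p i.castSucc + α ^ n) := by field_simp
  have hden : p i.succ - α ^ n * p i.castSucc =
      p i.castSucc * (p i.succ / p i.castSucc - α ^ n) := by field_simp
  rw [colTuple, hopfCole, (h i).1, (h i).2, cayleyTuple, ratioTuple, hnum, hden,
    mul_div_mul_left _ _ hpi]

theorem IsColumnPotential.ne_zero (h : IsColumnPotential α v n m p) (hp : ∀ i, p i ≠ 0)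
    (hr : ∀ i, ratioTuple p i ≠ α ^ n) (i : Fin (k + 1)) : v n (m + (i : ℕ)) ≠ 0 := by
  rw [(h i).1, sub_ne_zero]
  exact fun heq => hr i (div_eq_of_eq_mul (hp _) heq)

theorem notMem_firstIntegralOrders₁ (hα : α ≠ 0) (hneg : ∀ j ≤ k, α ^ j ≠ -1)
    (hinj : Function.Injective fun j : Fin (k + 2) => α ^ (j : ℕ)) :
    k ∉ firstIntegralOrders₁ (burgersSolutions α) := by
  rintro ⟨w, D, hfam, hw⟩
  obtain ⟨n, m, x, hx, hne⟩ := hfam.deriv_last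
  refine hne ?_
  rw [fderiv_eq_zero_of_shiftRelation_chain_comp (β := fun _ => -1) (c := α ^ n)
    (zpow_ne_zero n hα) hα (fun _ j hj => by simpa [neg_eq_iff_eq_neg] using hneg j hj)
    (fun _ => (mul_left_injective₀ (neg_ne_zero.2 one_ne_zero)).comp hinj)
    (fun _ => isDenseSubmersion_ratioTuple) (hfam.isOpen n) (hfam.dense n) (hfam.holomorphic n)
    (fun s p q hpq hp hq => ?_) m hx, zero_apply]
  obtain ⟨v, hv, hvp, hvq⟩ := exists_linearSolution_rows (m := s) hα hpq
  have hrel : rowTuple (hopfCole v) k n s ∈ D n s →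
      rowTuple (hopfCole v) k n (s + 1) ∈ D n (s + 1) →
      w n (s + 1) (rowTuple (hopfCole v) k n (s + 1)) = w n s (rowTuple (hopfCole v) k n s) :=
    hopfCole_eq_of_forall_mem_burgersSolutions hα
      (P := fun i : Fin (k + 1) => (n + (i : ℕ), s)) (Q := fun i => (n + (i : ℕ), s + 1))
      (hfam.isOpen n s) (hfam.isOpen n (s + 1)) (hfam.holomorphic n s).continuousOn
      (hfam.holomorphic n (s + 1)).continuousOn (fun u hu => hw u hu n s) hv
      (fun i => hvp i.castSucc ▸ mem_avoidingTuples.1 hp.1 _)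
      (fun i => hvq i.castSucc ▸ mem_avoidingTuples.1 hq.1 _)
  rw [rowTuple_hopfCole hvp, rowTuple_hopfCole hvq] at hrel
  exact hrel hp.2 hq.2

theorem notMem_firstIntegralOrders₂ (hα : α ≠ 0) (hneg : ∀ j ≤ k, α ^ j ≠ -1)
    (hinj : Function.Injective fun j : Fin (k + 2) => α ^ (j : ℕ)) :
    k ∉ firstIntegralOrders₂ (burgersSolutions α) := by
  rintro ⟨w, D, hfam, hw⟩
  obtain ⟨n, m, x, hx, hne⟩ := hfam.deriv_last
  have hβ (s : ℤ) (j : ℕ) : (1 : ℂ) ^ j * α ^ (s - j) = α ^ s * (α ^ j)⁻¹ := by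
    rw [one_pow, one_mul, zpow_sub₀ hα, zpow_natCast, div_eq_mul_inv]
  refine hne ?_
  rw [fderiv_eq_zero_of_shiftRelation_chain_comp (β := fun s => α ^ s) (c := -1)
    (neg_ne_zero.2 one_ne_zero) one_ne_zero (fun s j hj h => ?_) (fun s => ?_)
    (fun s => (isDenseSubmersion_cayleyTuple (zpow_ne_zero s hα)).comp isDenseSubmersion_ratioTuple)
    (fun s => hfam.isOpen s m) (fun s => hfam.dense s m) (fun s => hfam.holomorphic s m)
    (fun s p q hpq hp hq => ?_) n hx, zero_apply]
  · rw [hβ, ← mul_neg_one, mul_right_inj' (zpow_ne_zero s hα), inv_eq_iff_eq_inv] at h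
    exact hneg j hj (by simpa using h)
  · simp only [hβ]
    exact (mul_right_injective₀ (zpow_ne_zero s hα)).comp (inv_injective.comp hinj)
  obtain ⟨v, hv, hvp, hvq⟩ := exists_linearSolution_columns (m := m) hα hpq
  have hp₀ := mem_avoidingTuples.1 hp.1.1
  have hq₀ := mem_avoidingTuples.1 hq.1.1
  have hrel : colTuple (hopfCole v) k s m ∈ D s m →
      colTuple (hopfCole v) k (s + 1) m ∈ D (s + 1) m →
      w (s + 1) m (colTuple (hopfCole v) k (s + 1) m) = w s m (colTuple (hopfCole v) k s m) :=
    hopfCole_eq_of_forall_mem_burgersSolutions hα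
      (P := fun i : Fin (k + 1) => (s, m + (i : ℕ))) (Q := fun i => (s + 1, m + (i : ℕ)))
      (hfam.isOpen s m) (hfam.isOpen (s + 1) m) (hfam.holomorphic s m).continuousOn
      (hfam.holomorphic (s + 1) m).continuousOn (fun u hu => hw u hu s m) hv
      (hvp.ne_zero hp₀ (mem_avoidingTuples.1 hp.1.2))
      (hvq.ne_zero hq₀ (mem_avoidingTuples.1 hq.1.2))
  rw [hvp.colTuple_hopfCole hp₀, hvq.colTuple_hopfCole hq₀] at hrel
  exact hrel hp.2 hq.2

end LowerBounds

theorem isPrimitiveRoot_two_mul_iff {R : Type*} [CommRing R] [IsDomain R] [NeZero (2 : R)] {N : ℕ}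
    (hN : 1 ≤ N) {α : R} : IsPrimitiveRoot α (2 * N) ↔
      α ^ N = -1 ∧ ∀ j : ℕ, 1 ≤ j → j < N → α ^ j ≠ -1 := by
  constructor
  · intro h
    have hneg : α ^ N = -1 :=
      IsPrimitiveRoot.eq_neg_one_of_two_right (h.pow (by lia) (mul_comm 2 N))
    exact ⟨hneg, fun j _ hj heq => hj.ne (h.pow_inj (by lia) (by lia) (heq.trans hneg.symm))⟩
  · rintro ⟨hneg, hmin⟩
    have hne : (1 : R) ≠ -1 := fun h => NeZero.ne (2 : R) (by linear_combination h)
    refine IsPrimitiveRoot.mk_of_lt _ (by lia) (by rw [mul_comm, pow_mul, hneg, neg_one_sq])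
      fun j hj hj' hone => ?_
    rcases lt_trichotomy j N with h | rfl | h
    · refine hmin (N - j) (by lia) (by lia) ?_
      rw [← hneg, ← pow_sub_mul_pow α h.le, hone, mul_one]
    · exact hne (hone.symm.trans hneg)
    · refine hmin (j - N) (by lia) (by lia) ?_
      have := pow_sub_mul_pow α h.le
      rw [hone, hneg] at this
      linear_combination -this

theorem exists_isLeast_of_succ_mem {S : Set ℕ} {N : ℕ} (h : N + 1 ∈ S) (hS : ∀ k < N, k ∉ S) :
    ∃ k, IsLeast S k ∧ (k = N ∨ k = N + 1) := by
  have hle := Nat.sInf_le h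
  have hge : N ≤ sInf S := not_lt.1 fun hlt => hS _ hlt (Nat.sInf_mem ⟨_, h⟩)
  exact ⟨sInf S, ⟨Nat.sInf_mem ⟨_, h⟩, fun _ => Nat.sInf_le⟩, by lia⟩

theorem burgersSolutions_darboux {N : ℕ} (hN : 1 ≤ N) {α : ℂ} (hα : IsPrimitiveRoot α (2 * N)) :
    IsDarbouxIntegrable (burgersSolutions α) ∧
      IsFirstIntegral₁ (burgersSolutions α) (N + 1) (burgersIntegral₁ N α) ∧
      IsFirstIntegral₂ (burgersSolutions α) (N + 1) (burgersIntegral₂ N α) ∧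
      (∃ k, IsLeast (firstIntegralOrders₁ (burgersSolutions α)) k ∧ (k = N ∨ k = N + 1)) ∧
      (∃ l, IsLeast (firstIntegralOrders₂ (burgersSolutions α)) l ∧ (l = N ∨ l = N + 1)) := by
  have hα₀ : α ≠ 0 := hα.ne_zero (by lia)
  have hpow : α ^ N = -1 := ((isPrimitiveRoot_two_mul_iff hN).1 hα).1
  have hneg {k : ℕ} (hk : k < N) (j : ℕ) (hj : j ≤ k) : α ^ j ≠ -1 := fun h =>
    (hj.trans_lt hk).ne (hα.pow_inj (by lia) (by lia) (h.trans hpow.symm))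
  have hinj {k : ℕ} (hk : k < N) : Function.Injective fun j : Fin (k + 2) => α ^ (j : ℕ) :=
    fun i j h => Fin.ext (hα.pow_inj (by lia) (by lia) h)
  have h₁ := isFirstIntegral₁_burgersIntegral₁ hpow
  have h₂ := isFirstIntegral₂_burgersIntegral₂ hpow
  exact ⟨⟨⟨_, _, h₁⟩, _, _, h₂⟩, h₁, h₂,
    exists_isLeast_of_succ_mem ⟨_, h₁⟩ fun _ hk =>
      notMem_firstIntegralOrders₁ hα₀ (hneg hk) (hinj hk),
    exists_isLeast_of_succ_mem ⟨_, h₂⟩ fun _ hk =>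
      notMem_firstIntegralOrders₂ hα₀ (hneg hk) (hinj hk)⟩

theorem mainTheorem1 :
    (∀ (N : ℕ) (α : ℂ), 1 ≤ N → α ^ N = -1 → (∀ j : ℕ, 1 ≤ j → j < N → α ^ j ≠ -1) →
      IsDarbouxIntegrable (burgersSolutions α) ∧
      IsFirstIntegral₁ (burgersSolutions α) (N + 1) (burgersIntegral₁ N α) ∧
      IsFirstIntegral₂ (burgersSolutions α) (N + 1) (burgersIntegral₂ N α) ∧
      (∃ k, IsLeast (firstIntegralOrders₁ (burgersSolutions α)) k ∧ (k = N ∨ k = N + 1)) ∧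
      (∃ l, IsLeast (firstIntegralOrders₂ (burgersSolutions α)) l ∧ (l = N ∨ l = N + 1))) ∧
    (∀ M : ℕ, ∃ α : ℂ, α ≠ 0 ∧ IsDarbouxIntegrable (burgersSolutions α) ∧
      (∃ k, IsLeast (firstIntegralOrders₁ (burgersSolutions α)) k ∧ M ≤ k) ∧
      (∃ l, IsLeast (firstIntegralOrders₂ (burgersSolutions α)) l ∧ M ≤ l)) := by
  refine ⟨fun N α hN hα hmin => burgersSolutions_darboux hN
    ((isPrimitiveRoot_two_mul_iff hN).2 ⟨hα, hmin⟩), fun M => ?_⟩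
  have hα := Complex.isPrimitiveRoot_exp (2 * (M + 1)) (by lia)
  obtain ⟨hdarboux, -, -, ⟨k, hk, hkM⟩, l, hl, hlM⟩ := burgersSolutions_darboux M.succ_pos hα
  exact ⟨_, hα.ne_zero (by lia), hdarboux, ⟨k, hk, by lia⟩, l, hl, by lia⟩
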